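/- Let $V$ be a simple vertex operator algebra over $\mathbb C$ and let $g$ be an automorphism of $V$ of finite order $K$, with eigenspaces $V^r=\{v: gv=e^{2\pi i r/K}v\}$. Let $\mathcal C_g$ be the category of $g$-twisted $V$-modules (these are $\mathbb C$-graded by the eigenvalues of $L(0)$, with finite-dimensional weight spaces $M_\lambda$ such that, for each $\lambda$, $M_{\lambda+n}=0$ for all sufficiently small integers $n$), and let $\mathcal C^0_1$ be the category of untwisted modules, in the same sense, for the vertex operator algebra $V^0$. The induction functor is defined as follows. Let $\bar V=\bigoplus_{r=0}^{K-1}V^r\otimes t^{r/K}\mathbb C[t,t^{-1}]$; it acts on every $M\in\mathcal C_g$ by $v\otimes t^n\mapsto v_n$. Let $U_g(V)=T(\bar V)/I$, where $T(\bar V)$ is the tensor algebra and $I$ is the ideal of the elements that act as zero on all $M\in\mathcal C_g$; it is graded by $\deg(v\otimes t^n)=\mathrm{wt}\,v-n-1$. Let $C\subset\bigoplus_\mu U_g(V)_\mu[[X]]$ be the algebra of those series $\sum_i a_iX^i$ such that for all $M\in\mathcal C_g$ and $m\in M$ one has $a_im=0$ for all but finitely many $i$; it acts on $M$ by $(\sum_i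 a_iX^i)m=\sum_i a_im$. Let $A(g)$ be the quotient of $C$ by the ideal of the elements that act as zero on all $M\in\mathcal C_g$. Each $M \in \mathcal C_g$ is thus an $A(g)$-module, and an $A(g)$-module is said to lie in $\mathcal C_g$ if it is isomorphic to one of these. For an $A(g)$-module $X$, let $\mathcal F(X)$ be the submodule of all $x\in X$ whose annihilator in $A(g)$ contains $\mathrm{Ann}_{A(g)}(m)$ for some $m\in M$, $M\in\mathcal C_g$. Let $A^0$ be the algebra constructed in the same way from $V^0$ and its identity automorphism; the inclusion $V^0\subset V$ induces an algebra homomorphism $A^0\to A(g)$. For $N\in\mathcal C^0_1$ put $$\mathrm{Ind}\,N=\mathcal F\big(\mathrm{Hom}_{A^0}(A(g),N)\big),\qquad (af)(x)=f(xa).$$ For a simple $M\in\mathcal C_g$, let $\lambda$ be its unique minimal weight, i.e. the weight such that no $\lambda-j/K$ with $j\ge1$ is a weight of $M$, and for $0\le r<K$ put $M^r=\bigoplus_{n\in\mathbb Z}M_{\lambda-r/K+n}$, a $V^0$-submodule of $M$. Suppose that $\mathcal C_g$ is semisimple, i.e. every $g$-twisted $V$-module is a direct sum of simple ones. Then: (1)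 For every simple $V^0$-module $N\in\mathcal C^0_1$: if $N\cong M^r$ as $V^0$-modules for a simple $M\in\mathcal C_g$ and some $0\le r<K$, then $\mathrm{Ind}\,N\cong M$ as $A(g)$-modules; if there are no such $M$ and $r$, then $\mathrm{Ind}\,N=0$. (2) If moreover $\mathcal C_g$ has only finitely many simple modules up to isomorphism, then $\mathrm{Ind}\,N$ lies in $\mathcal C_g$ for every $N\in\mathcal C^0_1$. -/

import Mathlib

universe u

open Filter

noncomputable section

namespace TwistedVOA

/-- A vertex operator algebra `(V, Y, 𝟏, ω)` over `ℂ`, in component form: `mode n u v` is `u_n v`,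
where `Y(u, z) = ∑_{n ∈ ℤ} u_n z^{-n-1}`, and `L(n) = ω_{n+1}`. The homogeneous space `V_n` of the
`ℤ`-grading is the `n`-eigenspace of `L(0) = ω_1`.
All sums in the Jacobi identity are finite by `truncation`, so both sides of its component form
are the eventual values of their partial sums. -/
class VertexOperatorAlgebra (V : Type u) [AddCommGroup V] [Module ℂ V] where
  mode : ℤ → V →ₗ[ℂ] V →ₗ[ℂ] V
  vac : V
  conf : V
  rank : ℂ
  truncation : ∀ u v : V, ∃ N : ℤ, ∀ n : ℤ, N ≤ n → mode n u v = 0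
  vac_mode : ∀ (n : ℤ) (v : V), mode n vac v = if n = -1 then v else 0
  creation : ∀ v : V, mode (-1) v vac = v ∧ ∀ n : ℤ, 0 ≤ n → mode n v vac = 0
  /-- the coefficient of `z₀^{-p-1} z₁^{-s-1} z₂^{-t-1}` in the Jacobi identity -/
  jacobi : ∀ (u v w : V) (p s t : ℤ), ∀ᶠ N : ℕ in atTop,
    ∑ m ∈ Finset.range N, ((-1 : ℂ) ^ m * Ring.choose (p : ℂ) m) •
        (mode (p + s - m) u (mode (t + m) v w)
          - (-1 : ℂ) ^ p • mode (p + t - m) v (mode (s + m) u w)) =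
      ∑ m ∈ Finset.range N, Ring.choose (s : ℂ) m • mode (s + t - m) (mode (p + m) u v) w
  virasoro : ∀ (m n : ℤ) (v : V),
    mode (m + 1) conf (mode (n + 1) conf v) - mode (n + 1) conf (mode (m + 1) conf v) =
      ((m : ℂ) - n) • mode (m + n + 1) conf v
        + (if m + n = 0 then ((m : ℂ) ^ 3 - m) / 12 * rank else 0) • v
  /-- `V = ⊕_{n ∈ ℤ} V_n` -/
  grading : ⨆ n : ℤ, Module.End.eigenspace (mode 1 conf) (n : ℂ) = ⊤
  grading_finite : ∀ n : ℤ, FiniteDimensional ℂ (Module.End.eigenspace (mode 1 conf) (n : ℂ))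
  grading_bounded : ∃ N : ℤ, ∀ n : ℤ, n < N → Module.End.eigenspace (mode 1 conf) (n : ℂ) = ⊥
  /-- `d/dz Y(v, z) = Y(L(-1) v, z)` -/
  derivative : ∀ (n : ℤ) (v w : V), mode n (mode 0 conf v) w = -(n : ℂ) • mode (n - 1) v w

section VOA

variable {V : Type u} [AddCommGroup V] [Module ℂ V] [VertexOperatorAlgebra V]

/-- The weight space `V_n = {v | L(0) v = n v}`. -/
def homogeneous (V : Type u) [AddCommGroup V] [Module ℂ V] [VertexOperatorAlgebra V] (n : ℤ) :
    Submodule ℂ V :=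
  Module.End.eigenspace (VertexOperatorAlgebra.mode 1 VertexOperatorAlgebra.conf) (n : ℂ)

/-- `V` is simple: `V ≠ 0`, and `0` and `V` are the only submodules of the `V`-module `V`. -/
def IsSimpleVOA (V : Type u) [AddCommGroup V] [Module ℂ V] [VertexOperatorAlgebra V] : Prop :=
  Nontrivial V ∧ ∀ W : Submodule ℂ V,
    (∀ (n : ℤ) (u : V), ∀ w ∈ W, VertexOperatorAlgebra.mode n u w ∈ W) → W = ⊥ ∨ W = ⊤

/-- The group of automorphisms of the vertex operator algebra `V`. -/
def VOAut (V : Type u) [AddCommGroup V] [Module ℂ V] [VertexOperatorAlgebra V] :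
    Subgroup (V ≃ₗ[ℂ] V) where
  carrier := {g | (∀ (n : ℤ) (u v : V), g (VertexOperatorAlgebra.mode n u v) =
      VertexOperatorAlgebra.mode n (g u) (g v)) ∧
    g VertexOperatorAlgebra.vac = VertexOperatorAlgebra.vac ∧
    g VertexOperatorAlgebra.conf = VertexOperatorAlgebra.conf}
  mul_mem' := by
    rintro a b ⟨ha, ha', ha''⟩ ⟨hb, hb', hb''⟩
    refine ⟨fun n u v => ?_, ?_, ?_⟩ <;> simp [LinearEquiv.mul_apply, *]
  one_mem' := ⟨fun _ _ _ => rfl, rfl, rfl⟩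
  inv_mem' := by
    rintro a ⟨ha, ha', ha''⟩
    have key : ∀ x, a (a⁻¹ x) = x := fun x => a.apply_symm_apply x
    refine ⟨fun n u v => ?_, ?_, ?_⟩ <;> apply a.injective <;> simp [*]

/-- The eigenspace `V^r = {v | g v = e^{2πir/K} v}`, where `K` is the order of `g`. -/
def eig (g : VOAut V) (r : ℤ) : Submodule ℂ V :=
  Module.End.eigenspace ((g : V ≃ₗ[ℂ] V) : V →ₗ[ℂ] V)
    (Complex.exp (2 * Real.pi * Complex.I * r / orderOf g))

/-- `n ∈ r/K + ℤ`, where `K` is the order of `g`. -/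
def modeIndex (g : VOAut V) (r : ℤ) (n : ℚ) : Prop :=
  ∃ k : ℤ, n = (r : ℚ) / orderOf g + k

/-- The space `V^0` of `g`-invariants. -/
def fixed (g : VOAut V) : Submodule ℂ V where
  carrier := {v | (g : V ≃ₗ[ℂ] V) v = v}
  add_mem' := by
    intro a b ha hb
    simp only [Set.mem_ofPred_eq] at *
    rw [map_add, ha, hb]
  zero_mem' := map_zero _
  smul_mem' := by
    intro c a ha
    simp only [Set.mem_ofPred_eq] at *
    rw [map_smul, ha]

theorem mem_fixed {g : VOAut V} {v : V} : v ∈ fixed g ↔ (g : V ≃ₗ[ℂ] V) v = v := Iff.rfl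

theorem mem_eig_zero {g : VOAut V} {v : V} (hv : v ∈ fixed g) : v ∈ eig g 0 := by
  rw [eig, Module.End.mem_eigenspace_iff]
  simpa using mem_fixed.1 hv

theorem mode_mem_fixed (g : VOAut V) (n : ℤ) {u v : V} (hu : u ∈ fixed g) (hv : v ∈ fixed g) :
    VertexOperatorAlgebra.mode n u v ∈ fixed g := by
  rw [mem_fixed] at *
  rw [g.2.1, hu, hv]

/-- The modes of `V^0`. -/
def fixedMode (g : VOAut V) (n : ℤ) : fixed g →ₗ[ℂ] fixed g →ₗ[ℂ] fixed g :=
  LinearMap.mk₂ ℂ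
    (fun u v => ⟨VertexOperatorAlgebra.mode n (u : V) (v : V), mode_mem_fixed g n u.2 v.2⟩)
    (fun _ _ _ => Subtype.ext (by simp)) (fun _ _ _ => Subtype.ext (by simp))
    (fun _ _ _ => Subtype.ext (by simp)) (fun _ _ _ => Subtype.ext (by simp))

@[simp] theorem coe_fixedMode (g : VOAut V) (n : ℤ) (u v : fixed g) :
    (fixedMode g n u v : V) = VertexOperatorAlgebra.mode n (u : V) (v : V) := rfl

/-- The invariants form a graded subspace. -/
theorem fixed_grading (g : VOAut V) :
    ⨆ n : ℤ, Module.End.eigenspace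
      (fixedMode g 1 ⟨VertexOperatorAlgebra.conf, g.2.2.2⟩) (n : ℂ) = ⊤ := by
  classical
  have hind : iSupIndep (homogeneous V) :=
    (Module.End.eigenspaces_iSupIndep _).comp (f := fun n : ℤ => (n : ℂ)) Int.cast_injective
  have htop : ⨆ n, homogeneous V n = ⊤ := VertexOperatorAlgebra.grading
  have hgm : ∀ n, ∀ x ∈ homogeneous V n, (g : V ≃ₗ[ℂ] V) x ∈ homogeneous V n := by
    intro n x hx
    rw [homogeneous, Module.End.mem_eigenspace_iff] at *
    have h := congrArg (g : V ≃ₗ[ℂ] V) hx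
    rw [g.2.1, g.2.2.2, map_smul] at h
    exact h
  rw [eq_top_iff]
  rintro ⟨v, hv⟩ -
  have hv' : v ∈ ⨆ n, homogeneous V n := htop ▸ Submodule.mem_top
  obtain ⟨f, hf⟩ := (Submodule.mem_iSup_iff_exists_dfinsupp' _ _).1 hv'
  have hfix : ∀ n, (f n : V) ∈ fixed g := by
    intro n
    by_cases hn : n ∈ f.support
    · have h0 : ∑ i ∈ f.support, ((g : V ≃ₗ[ℂ] V) (f i : V) - f i) = 0 := by
        rw [Finset.sum_sub_distrib, ← map_sum]
        have hs : ∑ i ∈ f.support, (f i : V) = v := hf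
        rw [hs, mem_fixed.1 hv, sub_self]
      exact sub_eq_zero.1 ((iSupIndep_iff_finsetSum_eq_zero_imp_eq_zero _).1 hind f.support _
        (fun i _ => Submodule.sub_mem _ (hgm i _ (f i).2) (f i).2) h0 n hn)
    · rw [DFinsupp.notMem_support_iff.1 hn]
      exact Submodule.zero_mem _
  have hsum : (⟨v, hv⟩ : fixed g) = ∑ n ∈ f.support, ⟨(f n : V), hfix n⟩ := by
    apply Subtype.ext
    rw [AddSubmonoidClass.coe_finsetSum]
    exact hf.symm
  rw [hsum]
  refine Submodule.sum_mem _ fun n _ => Submodule.mem_iSup_of_mem n ?_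
  rw [Module.End.mem_eigenspace_iff]
  exact Subtype.ext (Module.End.mem_eigenspace_iff.1 (f n).2)

theorem coe_mem_homogeneous {g : VOAut V} {n : ℤ} {x : fixed g}
    (hx : x ∈ Module.End.eigenspace
      (fixedMode g 1 ⟨VertexOperatorAlgebra.conf, g.2.2.2⟩) (n : ℂ)) :
    (x : V) ∈ homogeneous V n := by
  rw [homogeneous, Module.End.mem_eigenspace_iff] at *
  exact congrArg Subtype.val hx

/-- The vertex operator algebra `V^0`. -/
instance fixedVOA (g : VOAut V) : VertexOperatorAlgebra (fixed g) where
  mode := fixedMode g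
  vac := ⟨VertexOperatorAlgebra.vac, g.2.2.1⟩
  conf := ⟨VertexOperatorAlgebra.conf, g.2.2.2⟩
  rank := VertexOperatorAlgebra.rank V
  truncation u v := by
    obtain ⟨N, hN⟩ := VertexOperatorAlgebra.truncation (u : V) (v : V)
    exact ⟨N, fun n hn => Subtype.ext (hN n hn)⟩
  vac_mode n v := by
    apply Subtype.ext
    have := VertexOperatorAlgebra.vac_mode n (v : V)
    split_ifs at this ⊢ <;> simpa using this
  creation v := by
    obtain ⟨h1, h2⟩ := VertexOperatorAlgebra.creation (v : V)
    exact ⟨Subtype.ext h1, fun n hn => Subtype.ext (h2 n hn)⟩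
  jacobi u v w p s t := by
    filter_upwards [VertexOperatorAlgebra.jacobi (u : V) (v : V) (w : V) p s t] with N hN
    apply Subtype.ext
    simpa using hN
  virasoro m n v := Subtype.ext (VertexOperatorAlgebra.virasoro m n (v : V))
  grading := fixed_grading g
  grading_finite n := by
    have : FiniteDimensional ℂ (homogeneous V n) := VertexOperatorAlgebra.grading_finite n
    refine FiniteDimensional.of_injective
      ((fixed g).subtype.restrict (q := homogeneous V n) fun x hx => coe_mem_homogeneous hx) ?_
    intro x y hxy
    exact Subtype.ext (Subtype.ext (congrArg (fun z : homogeneous V n => (z : V)) hxy))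
  grading_bounded := by
    obtain ⟨N, hN⟩ := VertexOperatorAlgebra.grading_bounded (V := V)
    refine ⟨N, fun n hn => (Submodule.eq_bot_iff _).2 fun x hx => Subtype.ext ?_⟩
    have h := coe_mem_homogeneous hx
    rw [homogeneous, hN n hn] at h
    exact (Submodule.mem_bot ℂ).1 h
  derivative n v w := Subtype.ext (by
    simpa using VertexOperatorAlgebra.derivative n (v : V) (w : V))

/-- A `g`-twisted `V`-module `(M, Y_M)`, in component form: `mode n v` is `v_n`, where
`Y_M(v, z) = ∑_{n ∈ ℚ} v_n z^{-n-1}`. The homogeneous space `M_c` of the `ℂ`-grading is the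
`c`-eigenspace of `L(0) = ω_1`. -/
structure TwistedModule (g : VOAut V) : Type (u + 1) where
  carrier : Type u
  [addCommGroup : AddCommGroup carrier]
  [module : Module ℂ carrier]
  mode : ℚ → V →ₗ[ℂ] carrier →ₗ[ℂ] carrier
  /-- `Y_M(v, z) = ∑_{n ∈ r/K + ℤ} v_n z^{-n-1}` for `v ∈ V^r` -/
  mode_support : ∀ (r : ℤ), ∀ v ∈ eig g r, ∀ n : ℚ, ¬ modeIndex g r n → mode n v = 0
  truncation : ∀ (v : V) (w : carrier), ∃ N : ℚ, ∀ n : ℚ, N ≤ n → mode n v w = 0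
  vac_mode : ∀ (n : ℚ) (w : carrier),
    mode n VertexOperatorAlgebra.vac w = if n = -1 then w else 0
  /-- the coefficient of `z₀^{-p-1} z₁^{-s-1} z₂^{-t-1}` in the twisted Jacobi identity -/
  jacobi : ∀ (r : ℤ), ∀ u ∈ eig g r, ∀ (v : V) (w : carrier) (p : ℤ) (s t : ℚ),
    modeIndex g r s → ∀ᶠ N : ℕ in atTop,
    ∑ m ∈ Finset.range N, ((-1 : ℂ) ^ m * Ring.choose (p : ℂ) m) •
        (mode (p + s - m) u (mode (t + m) v w)
          - (-1 : ℂ) ^ p • mode (p + t - m) v (mode (s + m) u w)) =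
      ∑ m ∈ Finset.range N, Ring.choose (s : ℂ) m •
        mode (s + t - m) (VertexOperatorAlgebra.mode (p + m) u v) w
  virasoro : ∀ (m n : ℤ) (w : carrier),
    mode (m + 1) VertexOperatorAlgebra.conf (mode (n + 1) VertexOperatorAlgebra.conf w)
      - mode (n + 1) VertexOperatorAlgebra.conf (mode (m + 1) VertexOperatorAlgebra.conf w) =
      ((m : ℂ) - n) • mode (m + n + 1) VertexOperatorAlgebra.conf w
        + (if m + n = 0 then ((m : ℂ) ^ 3 - m) / 12 * VertexOperatorAlgebra.rank V else 0) • w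
  /-- `M = ⊕_{c ∈ ℂ} M_c` -/
  grading : ⨆ c : ℂ, Module.End.eigenspace (mode 1 VertexOperatorAlgebra.conf) c = ⊤
  grading_finite : ∀ c : ℂ,
    FiniteDimensional ℂ (Module.End.eigenspace (mode 1 VertexOperatorAlgebra.conf) c)
  grading_bounded : ∀ c : ℂ, ∃ N : ℤ, ∀ n : ℤ, n < N →
    Module.End.eigenspace (mode 1 VertexOperatorAlgebra.conf) (n + c) = ⊥
  /-- `d/dz Y_M(v, z) = Y_M(L(-1) v, z)` -/
  derivative : ∀ (n : ℚ) (v : V) (w : carrier),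
    mode n (VertexOperatorAlgebra.mode 0 VertexOperatorAlgebra.conf v) w =
      -(n : ℂ) • mode (n - 1) v w

attribute [instance] TwistedModule.addCommGroup TwistedModule.module

namespace TwistedModule

variable {g : VOAut V}

/-- The weight space `M_c = {w | L(0) w = c w}`. -/
def weightSpace (M : TwistedModule g) (c : ℂ) : Submodule ℂ M.carrier :=
  Module.End.eigenspace (M.mode 1 VertexOperatorAlgebra.conf) c

/-- Stability under all operators `v_n`; the stable subspaces are the submodules of `M`. -/
def IsInvariant (M : TwistedModule g) (W : Submodule ℂ M.carrier) : Prop :=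
  ∀ (n : ℚ) (v : V), ∀ w ∈ W, M.mode n v w ∈ W

/-- `M` is a simple module. -/
def IsSimple (M : TwistedModule g) : Prop :=
  Nontrivial M.carrier ∧ ∀ W, M.IsInvariant W → W = ⊥ ∨ W = ⊤

/-- `W` is a simple submodule of `M`. -/
def IsSimpleSubmodule (M : TwistedModule g) (W : Submodule ℂ M.carrier) : Prop :=
  M.IsInvariant W ∧ W ≠ ⊥ ∧ ∀ W' ≤ W, M.IsInvariant W' → W' = ⊥ ∨ W' = W

/-- `M` is the direct sum of a family of simple submodules. -/
def IsCompletelyReducible (M : TwistedModule g) : Prop :=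
  ∃ S : Set (Submodule ℂ M.carrier),
    (∀ W ∈ S, M.IsSimpleSubmodule W) ∧ sSupIndep S ∧ sSup S = ⊤

/-- `M` and `M'` are isomorphic `g`-twisted `V`-modules. -/
def Iso (M M' : TwistedModule g) : Prop :=
  ∃ φ : M.carrier ≃ₗ[ℂ] M'.carrier, ∀ (n : ℚ) (v : V) (w : M.carrier),
    φ (M.mode n v w) = M'.mode n v (φ w)

/-- `c` is a minimal weight of `M`: it is a weight and no `c - j/K` with `j > 0` is one, where
`K` is the order of `g`. A simple module has exactly one minimal weight. -/
def IsMinimalWeight (M : TwistedModule g) (c : ℂ) : Prop :=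
  M.weightSpace c ≠ ⊥ ∧ ∀ j : ℕ, 0 < j → M.weightSpace (c - j / orderOf g) = ⊥

/-- The `V^0`-component `M^r = ⊕_{n ∈ ℤ} M_{c - r/K + n}` of a module `M` with minimal
weight `c`. -/
def component (M : TwistedModule g) (c : ℂ) (r : ℕ) : Submodule ℂ M.carrier :=
  ⨆ n : ℤ, M.weightSpace (c - r / orderOf g + n)

/-- The zero module. -/
def zero (g : VOAut V) : TwistedModule g where
  carrier := PUnit
  mode := 0
  mode_support _ _ _ _ _ := rfl
  truncation _ _ := ⟨0, fun _ _ => rfl⟩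
  vac_mode _ _ := rfl
  jacobi _ _ _ _ _ _ _ _ _ := Eventually.of_forall fun _ => rfl
  virasoro _ _ _ := rfl
  grading := Subsingleton.elim _ _
  grading_finite _ := inferInstance
  grading_bounded _ := ⟨0, fun _ _ => Subsingleton.elim _ _⟩
  derivative _ _ _ := rfl

theorem eigenspace_prodMap {A B : Type u} [AddCommGroup A] [Module ℂ A] [AddCommGroup B]
    [Module ℂ B] (f : A →ₗ[ℂ] A) (h : B →ₗ[ℂ] B) (c : ℂ) :
    Module.End.eigenspace (f.prodMap h) c =
      (Module.End.eigenspace f c).prod (Module.End.eigenspace h c) := by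
  ext ⟨a, b⟩
  simp [Submodule.mem_prod, Prod.ext_iff]

theorem iSup_prod_eq_top {A B : Type u} [AddCommGroup A] [Module ℂ A] [AddCommGroup B]
    [Module ℂ B] {p : ℂ → Submodule ℂ A} {q : ℂ → Submodule ℂ B} (hp : ⨆ c, p c = ⊤)
    (hq : ⨆ c, q c = ⊤) : ⨆ c, (p c).prod (q c) = ⊤ := by
  rw [eq_top_iff]
  rintro ⟨a, b⟩ -
  have ha : (a, (0 : B)) ∈ ⨆ c, (p c).prod (q c) := by
    have h : a ∈ ⨆ c, p c := hp ▸ Submodule.mem_top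
    have h' := Submodule.mem_map_of_mem (f := LinearMap.inl ℂ A B) h
    rw [Submodule.map_iSup] at h'
    refine SetLike.le_def.1 (iSup_mono fun c => ?_) h'
    rintro _ ⟨x, hx, rfl⟩
    exact ⟨hx, Submodule.zero_mem _⟩
  have hb : ((0 : A), b) ∈ ⨆ c, (p c).prod (q c) := by
    have h : b ∈ ⨆ c, q c := hq ▸ Submodule.mem_top
    have h' := Submodule.mem_map_of_mem (f := LinearMap.inr ℂ A B) h
    rw [Submodule.map_iSup] at h'
    refine SetLike.le_def.1 (iSup_mono fun c => ?_) h'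
    rintro _ ⟨x, hx, rfl⟩
    exact ⟨Submodule.zero_mem _, hx⟩
  simpa using Submodule.add_mem _ ha hb

/-- The direct sum of two modules. -/
def prod (M M' : TwistedModule g) : TwistedModule g where
  carrier := M.carrier × M'.carrier
  mode n :=
    { toFun := fun v => (M.mode n v).prodMap (M'.mode n v)
      map_add' := fun _ _ => by ext <;> simp
      map_smul' := fun _ _ => by ext <;> simp }
  mode_support r v hv n hn := by
    ext w <;> simp [M.mode_support r v hv n hn, M'.mode_support r v hv n hn]
  truncation v w := by
    obtain ⟨N, hN⟩ := M.truncation v w.1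
    obtain ⟨N', hN'⟩ := M'.truncation v w.2
    exact ⟨max N N', fun n hn => Prod.ext (hN n (le_trans (le_max_left _ _) hn))
      (hN' n (le_trans (le_max_right _ _) hn))⟩
  vac_mode n w := by
    simp only [LinearMap.coe_mk, AddHom.coe_mk, LinearMap.prodMap_apply, M.vac_mode, M'.vac_mode]
    split_ifs <;> rfl
  jacobi r u hu v w p s t hs := by
    filter_upwards [M.jacobi r u hu v w.1 p s t hs, M'.jacobi r u hu v w.2 p s t hs] with N h h'
    refine Prod.ext ?_ ?_
    · simpa [Prod.fst_sum] using h
    · simpa [Prod.snd_sum] using h'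
  virasoro m n w := Prod.ext (M.virasoro m n w.1) (M'.virasoro m n w.2)
  grading := by
    simp only [LinearMap.coe_mk, AddHom.coe_mk, eigenspace_prodMap]
    exact iSup_prod_eq_top M.grading M'.grading
  grading_finite c := by
    refine Module.Finite.iff_fg.2 ?_
    simp only [LinearMap.coe_mk, AddHom.coe_mk, eigenspace_prodMap]
    exact (Module.Finite.iff_fg.1 (M.grading_finite c)).prod
      (Module.Finite.iff_fg.1 (M'.grading_finite c))
  grading_bounded c := by
    obtain ⟨N, hN⟩ := M.grading_bounded c
    obtain ⟨N', hN'⟩ := M'.grading_bounded c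
    refine ⟨min N N', fun n hn => ?_⟩
    simp only [LinearMap.coe_mk, AddHom.coe_mk, eigenspace_prodMap]
    rw [hN n (lt_of_lt_of_le hn (min_le_left _ _)), hN' n (lt_of_lt_of_le hn (min_le_right _ _)),
      Submodule.prod_bot]
  derivative n v w := Prod.ext (M.derivative n v w.1) (M'.derivative n v w.2)

/-- The restriction of a `g`-twisted `V`-module to an untwisted `V^0`-module. -/
def res (M : TwistedModule g) : TwistedModule (1 : VOAut (fixed g)) where
  carrier := M.carrier
  mode n := (M.mode n).comp (fixed g).subtype
  mode_support r v _ n hn := by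
    refine M.mode_support 0 v (mem_eig_zero v.2) n fun ⟨k, hk⟩ => hn ⟨k - r, ?_⟩
    simp only [hk, orderOf_one]
    push_cast
    ring
  truncation v w := M.truncation v w
  vac_mode n w := M.vac_mode n w
  jacobi r u _ v w p s t hs := by
    refine M.jacobi 0 u (mem_eig_zero u.2) v w p s t ?_
    obtain ⟨k, hk⟩ := hs
    refine ⟨r + k, ?_⟩
    simp only [hk, orderOf_one]
    push_cast
    ring
  virasoro m n w := M.virasoro m n w
  grading := M.grading
  grading_finite c := M.grading_finite c
  grading_bounded c := M.grading_bounded c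
  derivative n v w := M.derivative n v w

/-- The untwisted `V^0`-module `N` is isomorphic to the component `M^r` of `M`. -/
def IsoComponent (N : TwistedModule (1 : VOAut (fixed g))) (M : TwistedModule g) (c : ℂ) (r : ℕ) :
    Prop :=
  ∃ φ : N.carrier ≃ₗ[ℂ] M.component c r, ∀ (n : ℚ) (v : fixed g) (x : N.carrier),
    (φ (N.mode n v x) : M.carrier) = M.mode n (v : V) (φ x)

end TwistedModule

/-! ### The twisted enveloping algebras -/

/-- `V̄ = ⊕_r V^r ⊗ t^{r/K} ℂ[t, t⁻¹]`, where `Finsupp.single n v` stands for `v ⊗ t^n`. -/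
def affinization (g : VOAut V) : Submodule ℂ (ℚ →₀ V) :=
  Submodule.span ℂ {x | ∃ (r : ℤ) (n : ℚ) (v : V), v ∈ eig g r ∧ modeIndex g r n ∧
    x = Finsupp.single n v}

/-- The homogeneous component `V̄_μ`, where `v ⊗ t^n` has degree `k - n - 1` for `v ∈ V_k`. -/
def affinizationGrade (g : VOAut V) (μ : ℚ) : Submodule ℂ (affinization g) :=
  Submodule.span ℂ {x | ∃ (r k : ℤ) (n : ℚ) (v : V), v ∈ eig g r ∧ v ∈ homogeneous V k ∧
    modeIndex g r n ∧ (k : ℚ) - n - 1 = μ ∧ (x : ℚ →₀ V) = Finsupp.single n v}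

/-- Products of homogeneous elements of `V̄` in the tensor algebra, with their total degree. -/
inductive IsMonomial (g : VOAut V) : ℚ → TensorAlgebra ℂ (affinization g) → Prop
  | one : IsMonomial g 0 1
  | mul {μ ν : ℚ} {x : affinization g} {y : TensorAlgebra ℂ (affinization g)} :
      x ∈ affinizationGrade g μ → IsMonomial g ν y →
      IsMonomial g (μ + ν) (TensorAlgebra.ι ℂ x * y)

theorem IsMonomial.mul' {g : VOAut V} {μ ν : ℚ} {x y : TensorAlgebra ℂ (affinization g)}
    (hx : IsMonomial g μ x) (hy : IsMonomial g ν y) : IsMonomial g (μ + ν) (x * y) := by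
  induction hx with
  | one => simpa using hy
  | mul h _ ih => rw [mul_assoc, add_assoc]; exact .mul h ih

/-- The homogeneous component of degree `μ` of the tensor algebra `T(V̄)`. -/
def tensorGrade (g : VOAut V) (μ : ℚ) : Submodule ℂ (TensorAlgebra ℂ (affinization g)) :=
  Submodule.span ℂ {x | IsMonomial g μ x}

/-- The representation `ρ_M : T(V̄) → End M`, `v ⊗ t^n ↦ v_n`. -/
def TwistedModule.rhoT {g : VOAut V} (M : TwistedModule g) :
    TensorAlgebra ℂ (affinization g) →ₐ[ℂ] Module.End ℂ M.carrier :=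
  TensorAlgebra.lift ℂ ((Finsupp.lsum ℂ M.mode).comp (affinization g).subtype)

theorem TwistedModule.rhoT_ι {g : VOAut V} (M : TwistedModule g) (y : affinization g) :
    M.rhoT (TensorAlgebra.ι ℂ y) = Finsupp.lsum ℂ M.mode (y : ℚ →₀ V) :=
  TensorAlgebra.lift_ι_apply _ _

/-- The ideal `I = ⋂_M ker ρ_M`, over all `g`-twisted `V`-modules `M`. -/
def kerIdeal (g : VOAut V) : Ideal (TensorAlgebra ℂ (affinization g)) where
  carrier := {x | ∀ M : TwistedModule g, M.rhoT x = 0}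
  add_mem' ha hb M := by rw [map_add, ha M, hb M, add_zero]
  zero_mem' M := map_zero _
  smul_mem' c x hx M := by rw [smul_eq_mul, map_mul, hx M, mul_zero]

instance (g : VOAut V) : (kerIdeal g).IsTwoSided where
  mul_mem_of_left b ha M := by rw [map_mul, ha M, zero_mul]

/-- The `g`-twisted enveloping algebra `U_g(V) = T(V̄) / I`. -/
def EnvAlg (g : VOAut V) : Type u := TensorAlgebra ℂ (affinization g) ⧸ kerIdeal g

instance (g : VOAut V) : Ring (EnvAlg g) :=
  inferInstanceAs (Ring (TensorAlgebra ℂ (affinization g) ⧸ kerIdeal g))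

instance (g : VOAut V) : Algebra ℂ (EnvAlg g) :=
  inferInstanceAs (Algebra ℂ (TensorAlgebra ℂ (affinization g) ⧸ kerIdeal g))

/-- The quotient map `T(V̄) → U_g(V)`. -/
def EnvAlg.mk (g : VOAut V) : TensorAlgebra ℂ (affinization g) →ₐ[ℂ] EnvAlg g :=
  Ideal.Quotient.mkₐ ℂ (kerIdeal g)

theorem EnvAlg.mk_surjective (g : VOAut V) : Function.Surjective (EnvAlg.mk g) :=
  Ideal.Quotient.mkₐ_surjective ℂ (kerIdeal g)

theorem EnvAlg.mk_eq_zero {g : VOAut V} {x : TensorAlgebra ℂ (affinization g)} :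
    EnvAlg.mk g x = 0 ↔ ∀ M : TwistedModule g, M.rhoT x = 0 :=
  Ideal.Quotient.eq_zero_iff_mem

/-- The homogeneous component `U_g(V)_μ`. -/
def envGrade (g : VOAut V) (μ : ℚ) : Submodule ℂ (EnvAlg g) :=
  (tensorGrade g μ).map (EnvAlg.mk g).toLinearMap

theorem envGrade_mul {g : VOAut V} {μ ν : ℚ} {a b : EnvAlg g} (ha : a ∈ envGrade g μ)
    (hb : b ∈ envGrade g ν) : a * b ∈ envGrade g (μ + ν) := by
  obtain ⟨x, hx, rfl⟩ := ha
  obtain ⟨y, hy, rfl⟩ := hb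
  refine ⟨x * y, ?_, by simp⟩
  have h : tensorGrade g μ * tensorGrade g ν ≤ tensorGrade g (μ + ν) := by
    rw [tensorGrade, tensorGrade, Submodule.span_mul_span]
    refine Submodule.span_mono ?_
    rintro _ ⟨x, hx, y, hy, rfl⟩
    exact IsMonomial.mul' hx hy
  exact h (Submodule.mul_mem_mul hx hy)

theorem envGrade_one (g : VOAut V) : (1 : EnvAlg g) ∈ envGrade g 0 :=
  ⟨1, Submodule.subset_span .one, by simp⟩

/-- The representation `ρ_M : U_g(V) → End M`. -/
def TwistedModule.rho {g : VOAut V} (M : TwistedModule g) :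
    EnvAlg g →ₐ[ℂ] Module.End ℂ M.carrier :=
  Ideal.Quotient.liftₐ (kerIdeal g) M.rhoT fun _ ha => ha M

@[simp] theorem TwistedModule.rho_mk {g : VOAut V} (M : TwistedModule g)
    (x : TensorAlgebra ℂ (affinization g)) : M.rho (EnvAlg.mk g x) = M.rhoT x := rfl

/-- The subspace `U_g(V)_μ[[X]]` of `U_g(V)[[X]]`. -/
def seriesGrade (g : VOAut V) (μ : ℚ) : Submodule ℂ (PowerSeries (EnvAlg g)) where
  carrier := {f | ∀ i, PowerSeries.coeff i f ∈ envGrade g μ}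
  add_mem' ha hb i := by rw [map_add]; exact Submodule.add_mem _ (ha i) (hb i)
  zero_mem' i := by rw [map_zero]; exact Submodule.zero_mem _
  smul_mem' c f hf i := by
    have : PowerSeries.coeff i (c • f) = c • PowerSeries.coeff i f := rfl
    rw [this]
    exact Submodule.smul_mem _ c (hf i)

/-- The subspace `⊕_μ U_g(V)_μ[[X]]` of `U_g(V)[[X]]`. -/
def gradedSeries (g : VOAut V) : Submodule ℂ (PowerSeries (EnvAlg g)) :=
  ⨆ μ : ℚ, seriesGrade g μ

theorem seriesGrade_mul {g : VOAut V} {μ ν : ℚ} {a b : PowerSeries (EnvAlg g)}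
    (ha : a ∈ seriesGrade g μ) (hb : b ∈ seriesGrade g ν) : a * b ∈ seriesGrade g (μ + ν) := by
  intro i
  rw [PowerSeries.coeff_mul]
  exact Submodule.sum_mem _ fun p _ => envGrade_mul (ha p.1) (hb p.2)

theorem gradedSeries_mul {g : VOAut V} {a b : PowerSeries (EnvAlg g)}
    (ha : a ∈ gradedSeries g) (hb : b ∈ gradedSeries g) : a * b ∈ gradedSeries g := by
  have h : gradedSeries g * gradedSeries g ≤ gradedSeries g := by
    rw [gradedSeries, Submodule.iSup_mul]
    refine iSup_le fun μ => ?_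
    rw [Submodule.mul_iSup]
    refine iSup_le fun ν => Submodule.mul_le.2 fun x hx y hy => ?_
    exact Submodule.mem_iSup_of_mem (μ + ν) (seriesGrade_mul hx hy)
  exact h (Submodule.mul_mem_mul ha hb)

theorem gradedSeries_algebraMap (g : VOAut V) (c : ℂ) :
    algebraMap ℂ (PowerSeries (EnvAlg g)) c ∈ gradedSeries g := by
  rw [Algebra.algebraMap_eq_smul_one]
  refine Submodule.smul_mem _ c (Submodule.mem_iSup_of_mem 0 fun i => ?_)
  rw [PowerSeries.coeff_one]
  split_ifs
  · exact envGrade_one g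
  · exact Submodule.zero_mem _

/-- `f = ∑ a_i X^i` lies in `C_M`: for each `m ∈ M`, `a_i m = 0` for all but finitely many `i`. -/
def TwistedModule.Summable {g : VOAut V} (M : TwistedModule g) (f : PowerSeries (EnvAlg g)) :
    Prop :=
  ∀ m : M.carrier, ∃ N : ℕ, ∀ i, N ≤ i → M.rho (PowerSeries.coeff i f) m = 0

/-- The action `f m = ∑ a_i m` of `f = ∑ a_i X^i` in `C_M`. -/
def TwistedModule.seriesAct {g : VOAut V} (M : TwistedModule g) (f : PowerSeries (EnvAlg g))
    (m : M.carrier) : M.carrier :=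
  ∑ᶠ i : ℕ, M.rho (PowerSeries.coeff i f) m

namespace TwistedModule

variable {g : VOAut V} (M : TwistedModule g)

theorem seriesAct_eq_sum {f : PowerSeries (EnvAlg g)} {m : M.carrier} {N : ℕ}
    (h : ∀ i, N ≤ i → M.rho (PowerSeries.coeff i f) m = 0) :
    M.seriesAct f m = ∑ i ∈ Finset.range N, M.rho (PowerSeries.coeff i f) m := by
  refine finsum_eq_sum_of_support_subset _ fun i hi => ?_
  by_contra hn
  exact hi (h i (by simpa using hn))

/-- A common bound for the two factors of a product. -/
theorem exists_bound {a b : PowerSeries (EnvAlg g)} (ha : M.Summable a) (hb : M.Summable b)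
    (m : M.carrier) : ∃ N N' : ℕ,
      (∀ j, N ≤ j → M.rho (PowerSeries.coeff j b) m = 0) ∧
      (∀ i j, N' ≤ i → M.rho (PowerSeries.coeff i a) (M.rho (PowerSeries.coeff j b) m) = 0) := by
  obtain ⟨N, hN⟩ := hb m
  choose F hF using fun j => ha (M.rho (PowerSeries.coeff j b) m)
  refine ⟨N, (Finset.range N).sup F, hN, fun i j hi => ?_⟩
  by_cases hj : j < N
  · exact hF j i (le_trans (Finset.le_sup (f := F) (Finset.mem_range.2 hj)) hi)
  · rw [hN j (not_lt.1 hj), map_zero]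

theorem coeff_mul_eq_zero {a b : PowerSeries (EnvAlg g)} {m : M.carrier} {N N' : ℕ}
    (h1 : ∀ j, N ≤ j → M.rho (PowerSeries.coeff j b) m = 0)
    (h2 : ∀ i j, N' ≤ i → M.rho (PowerSeries.coeff i a) (M.rho (PowerSeries.coeff j b) m) = 0)
    {k : ℕ} (hk : N' + N ≤ k) : M.rho (PowerSeries.coeff k (a * b)) m = 0 := by
  rw [PowerSeries.coeff_mul, map_sum, LinearMap.sum_apply]
  refine Finset.sum_eq_zero fun p hp => ?_
  rw [map_mul, Module.End.mul_apply]
  have := Finset.HasAntidiagonal.mem_antidiagonal.1 hp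
  by_cases hj : N ≤ p.2
  · rw [h1 _ hj, map_zero]
  · exact h2 _ _ (by omega)

theorem Summable.mul {M : TwistedModule g} {a b : PowerSeries (EnvAlg g)} (ha : M.Summable a)
    (hb : M.Summable b) : M.Summable (a * b) := by
  intro m
  obtain ⟨N, N', h1, h2⟩ := M.exists_bound ha hb m
  exact ⟨N' + N, fun k hk => M.coeff_mul_eq_zero h1 h2 hk⟩

theorem seriesAct_mul {a b : PowerSeries (EnvAlg g)} (ha : M.Summable a) (hb : M.Summable b)
    (m : M.carrier) : M.seriesAct (a * b) m = M.seriesAct a (M.seriesAct b m) := by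
  obtain ⟨N, N', h1, h2⟩ := M.exists_bound ha hb m
  have hbm := M.seriesAct_eq_sum h1
  have h3 : ∀ i, N' ≤ i → M.rho (PowerSeries.coeff i a) (M.seriesAct b m) = 0 := by
    intro i hi
    rw [hbm, map_sum]
    exact Finset.sum_eq_zero fun j _ => h2 i j hi
  rw [M.seriesAct_eq_sum (f := a * b) fun k hk => M.coeff_mul_eq_zero h1 h2 hk,
    M.seriesAct_eq_sum h3, hbm]
  simp only [map_sum]
  rw [← Finset.sum_product' (f := fun i j =>
      M.rho (PowerSeries.coeff i a) (M.rho (PowerSeries.coeff j b) m)),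
    ← Finset.sum_fiberwise_of_maps_to (t := Finset.range (N' + N)) (g := fun p : ℕ × ℕ => p.1 + p.2)
      (by
        intro p hp
        have := Finset.mem_product.1 hp
        simp only [Finset.mem_range] at *
        omega)]
  refine Finset.sum_congr rfl fun k _ => ?_
  rw [PowerSeries.coeff_mul, map_sum, LinearMap.sum_apply]
  symm
  simp only [map_mul, Module.End.mul_apply]
  refine Finset.sum_subset (fun p hp => ?_) fun p hp hnp => ?_
  · exact Finset.HasAntidiagonal.mem_antidiagonal.2 (Finset.mem_filter.1 hp).2
  · have hk := Finset.HasAntidiagonal.mem_antidiagonal.1 hp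
    by_cases hj : N ≤ p.2
    · rw [h1 _ hj, map_zero]
    · refine h2 _ _ (not_lt.1 fun hi => hnp ?_)
      simp only [Finset.mem_filter, Finset.mem_product, Finset.mem_range]
      exact ⟨⟨hi, not_le.1 hj⟩, hk⟩

end TwistedModule

namespace TwistedModule

variable {g : VOAut V} {M : TwistedModule g}

theorem Summable.add {a b : PowerSeries (EnvAlg g)} (ha : M.Summable a) (hb : M.Summable b) :
    M.Summable (a + b) := by
  intro m
  obtain ⟨N, hN⟩ := ha m
  obtain ⟨N', hN'⟩ := hb m
  refine ⟨max N N', fun i hi => ?_⟩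
  rw [map_add, map_add, LinearMap.add_apply, hN i (le_trans (le_max_left _ _) hi),
    hN' i (le_trans (le_max_right _ _) hi), add_zero]

theorem coeff_algebraMap_zero (c : ℂ) :
    PowerSeries.coeff 0 (algebraMap ℂ (PowerSeries (EnvAlg g)) c) = algebraMap ℂ _ c := by
  have h : algebraMap ℂ (PowerSeries (EnvAlg g)) c = PowerSeries.C (algebraMap ℂ _ c) :=
    PowerSeries.algebraMap_apply
  rw [h, PowerSeries.coeff_C, if_pos rfl]

theorem coeff_algebraMap (c : ℂ) {i : ℕ} (hi : 1 ≤ i) :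
    PowerSeries.coeff i (algebraMap ℂ (PowerSeries (EnvAlg g)) c) = 0 := by
  have h : algebraMap ℂ (PowerSeries (EnvAlg g)) c = PowerSeries.C (algebraMap ℂ _ c) :=
    PowerSeries.algebraMap_apply
  rw [h, PowerSeries.coeff_C, if_neg (by omega)]

theorem summable_algebraMap (c : ℂ) : M.Summable (algebraMap ℂ (PowerSeries (EnvAlg g)) c) :=
  fun _ => ⟨1, fun i hi => by rw [coeff_algebraMap c hi, map_zero, LinearMap.zero_apply]⟩

theorem seriesAct_algebraMap (c : ℂ) (m : M.carrier) :
    M.seriesAct (algebraMap ℂ (PowerSeries (EnvAlg g)) c) m = c • m := by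
  rw [M.seriesAct_eq_sum (N := 1) fun i hi => by
    rw [coeff_algebraMap c hi, map_zero, LinearMap.zero_apply], Finset.sum_range_one,
    coeff_algebraMap_zero, AlgHom.commutes]
  rfl

theorem seriesAct_add {a b : PowerSeries (EnvAlg g)} (ha : M.Summable a) (hb : M.Summable b)
    (m : M.carrier) : M.seriesAct (a + b) m = M.seriesAct a m + M.seriesAct b m := by
  obtain ⟨N, hN⟩ := ha m
  obtain ⟨N', hN'⟩ := hb m
  have h1 := fun i (hi : max N N' ≤ i) => hN i (le_trans (le_max_left _ _) hi)
  have h2 := fun i (hi : max N N' ≤ i) => hN' i (le_trans (le_max_right _ _) hi)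
  rw [M.seriesAct_eq_sum h1, M.seriesAct_eq_sum h2,
    M.seriesAct_eq_sum (f := a + b) (N := max N N') fun i hi => by
      rw [map_add, map_add, LinearMap.add_apply, h1 i hi, h2 i hi, add_zero],
    ← Finset.sum_add_distrib]
  simp only [map_add, LinearMap.add_apply]

theorem seriesAct_map {M' : TwistedModule g} (φ : M.carrier →ₗ[ℂ] M'.carrier)
    {f : PowerSeries (EnvAlg g)} (hf : M.Summable f)
    (hφ : ∀ (x : EnvAlg g) (m : M.carrier), φ (M.rho x m) = M'.rho x (φ m)) (m : M.carrier) :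
    φ (M.seriesAct f m) = M'.seriesAct f (φ m) := by
  obtain ⟨N, hN⟩ := hf m
  rw [M.seriesAct_eq_sum hN, M'.seriesAct_eq_sum (N := N) fun i hi => by
    rw [← hφ, hN i hi, map_zero], map_sum]
  simp only [hφ]

/-- The action of a summable series as a linear map. -/
def seriesEnd (M : TwistedModule g) (f : PowerSeries (EnvAlg g)) (hf : M.Summable f) :
    Module.End ℂ M.carrier where
  toFun := M.seriesAct f
  map_add' := by
    intro m m'
    obtain ⟨N, hN⟩ := hf m
    obtain ⟨N', hN'⟩ := hf m'
    have h1 := fun i (hi : max N N' ≤ i) => hN i (le_trans (le_max_left _ _) hi)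
    have h2 := fun i (hi : max N N' ≤ i) => hN' i (le_trans (le_max_right _ _) hi)
    rw [M.seriesAct_eq_sum h1, M.seriesAct_eq_sum h2,
      M.seriesAct_eq_sum (N := max N N') fun i hi => by rw [map_add, h1 i hi, h2 i hi, add_zero],
      ← Finset.sum_add_distrib]
    simp only [map_add]
  map_smul' := by
    intro c m
    obtain ⟨N, hN⟩ := hf m
    rw [RingHom.id_apply, M.seriesAct_eq_sum hN,
      M.seriesAct_eq_sum (N := N) fun i hi => by rw [map_smul, hN i hi, smul_zero],
      Finset.smul_sum]
    simp only [map_smul]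

theorem rhoT_map {M' : TwistedModule g} (φ : M.carrier →ₗ[ℂ] M'.carrier)
    (hφ : ∀ (n : ℚ) (v : V) (m : M.carrier), φ (M.mode n v m) = M'.mode n v (φ m))
    (x : TensorAlgebra ℂ (affinization g)) :
    ∀ m : M.carrier, φ (M.rhoT x m) = M'.rhoT x (φ m) := by
  induction x using TensorAlgebra.induction with
  | algebraMap c => intro m; simp [Module.algebraMap_end_apply]
  | ι y =>
    intro m
    simp only [rhoT, TensorAlgebra.lift_ι_apply, LinearMap.comp_apply, Submodule.subtype_apply,
      Finsupp.lsum_apply, Finsupp.sum, LinearMap.sum_apply, map_sum, hφ]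
  | mul a b ha hb => intro m; simp only [map_mul, Module.End.mul_apply, ha, hb]
  | add a b ha hb => intro m; simp only [map_add, LinearMap.add_apply, ha, hb]

theorem rho_map {M' : TwistedModule g} (φ : M.carrier →ₗ[ℂ] M'.carrier)
    (hφ : ∀ (n : ℚ) (v : V) (m : M.carrier), φ (M.mode n v m) = M'.mode n v (φ m))
    (x : EnvAlg g) (m : M.carrier) : φ (M.rho x m) = M'.rho x (φ m) := by
  obtain ⟨x, rfl⟩ := EnvAlg.mk_surjective g x
  exact rhoT_map φ hφ x m

end TwistedModule

/-- The algebra `C` of all `f` in `⊕_μ U_g(V)_μ[[X]]` that lie in `C_M` for every `g`-twisted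
`V`-module `M`. -/
def seriesAlg (g : VOAut V) : Subalgebra ℂ (PowerSeries (EnvAlg g)) where
  carrier := {f | f ∈ gradedSeries g ∧ ∀ M : TwistedModule g, M.Summable f}
  mul_mem' ha hb := ⟨gradedSeries_mul ha.1 hb.1, fun M => (ha.2 M).mul (hb.2 M)⟩
  add_mem' ha hb := ⟨Submodule.add_mem _ ha.1 hb.1, fun M => (ha.2 M).add (hb.2 M)⟩
  algebraMap_mem' c :=
    ⟨gradedSeries_algebraMap g c, fun _ => TwistedModule.summable_algebraMap c⟩

/-- The action of `C` on a `g`-twisted `V`-module. -/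
def TwistedModule.actC {g : VOAut V} (M : TwistedModule g) :
    seriesAlg g →ₐ[ℂ] Module.End ℂ M.carrier :=
  AlgHom.ofLinearMap
    { toFun := fun f => M.seriesEnd f.1 (f.2.2 M)
      map_add' := fun a b => LinearMap.ext fun m => seriesAct_add (a.2.2 M) (b.2.2 M) m
      map_smul' := fun c a => LinearMap.ext fun m => by
        have h : ((c • a : seriesAlg g) : PowerSeries (EnvAlg g)) =
          algebraMap ℂ (PowerSeries (EnvAlg g)) c * a.1 := Algebra.smul_def c a.1
        change M.seriesAct ((c • a : seriesAlg g) : PowerSeries (EnvAlg g)) m =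
          c • M.seriesAct a.1 m
        rw [h, M.seriesAct_mul (summable_algebraMap c) (a.2.2 M), seriesAct_algebraMap] }
    (LinearMap.ext fun m => by
      have h := seriesAct_algebraMap (M := M) 1 m
      rw [map_one, one_smul] at h
      exact h)
    (fun a b => LinearMap.ext fun m => M.seriesAct_mul (a.2.2 M) (b.2.2 M) m)

theorem TwistedModule.actC_apply {g : VOAut V} (M : TwistedModule g) (f : seriesAlg g)
    (m : M.carrier) : M.actC f m = M.seriesAct f.1 m := rfl

/-- The ideal `⋂_M Ann_C(M)`, over all `g`-twisted `V`-modules `M`. -/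
def annIdeal (g : VOAut V) : Ideal (seriesAlg g) where
  carrier := {f | ∀ M : TwistedModule g, M.actC f = 0}
  add_mem' ha hb M := by rw [map_add, ha M, hb M, add_zero]
  zero_mem' M := map_zero _
  smul_mem' c x hx M := by rw [smul_eq_mul, map_mul, hx M, mul_zero]

instance (g : VOAut V) : (annIdeal g).IsTwoSided where
  mul_mem_of_left b ha := fun M => by rw [map_mul, ha M, zero_mul]

/-- The algebra `A(g) = C / ⋂_M Ann_C(M)`. -/
def A (g : VOAut V) : Type u := seriesAlg g ⧸ annIdeal g

instance (g : VOAut V) : Ring (A g) := inferInstanceAs (Ring (seriesAlg g ⧸ annIdeal g))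

instance (g : VOAut V) : Algebra ℂ (A g) :=
  inferInstanceAs (Algebra ℂ (seriesAlg g ⧸ annIdeal g))

/-- The quotient map `C → A(g)`. -/
def A.mk (g : VOAut V) : seriesAlg g →ₐ[ℂ] A g := Ideal.Quotient.mkₐ ℂ (annIdeal g)

theorem A.mk_surjective (g : VOAut V) : Function.Surjective (A.mk g) :=
  Ideal.Quotient.mkₐ_surjective ℂ (annIdeal g)

theorem A.mk_eq_zero {g : VOAut V} {f : seriesAlg g} :
    A.mk g f = 0 ↔ ∀ M : TwistedModule g, M.actC f = 0 :=
  Ideal.Quotient.eq_zero_iff_mem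

/-- The action of `A(g)` on a `g`-twisted `V`-module. -/
def TwistedModule.actA {g : VOAut V} (M : TwistedModule g) :
    A g →ₐ[ℂ] Module.End ℂ M.carrier :=
  Ideal.Quotient.liftₐ (annIdeal g) M.actC fun _ ha => ha M

/-- A `g`-twisted `V`-module, regarded as an `A(g)`-module. -/
instance {g : VOAut V} (M : TwistedModule g) : Module (A g) M.carrier :=
  Module.compHom M.carrier M.actA.toRingHom

theorem TwistedModule.smul_mk {g : VOAut V} (M : TwistedModule g) (f : seriesAlg g)
    (m : M.carrier) : A.mk g f • m = M.seriesAct f.1 m := rfl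

theorem TwistedModule.smul_map {g : VOAut V} {M M' : TwistedModule g}
    (φ : M.carrier →ₗ[ℂ] M'.carrier)
    (hφ : ∀ (n : ℚ) (v : V) (m : M.carrier), φ (M.mode n v m) = M'.mode n v (φ m))
    (a : A g) (m : M.carrier) : φ (a • m) = a • φ m := by
  obtain ⟨f, rfl⟩ := A.mk_surjective g a
  exact seriesAct_map φ (f.2.2 M) (rho_map φ hφ) m

/-- The left ideal `Ann_{A(g)}(m)`. -/
def TwistedModule.ann {g : VOAut V} (M : TwistedModule g) (m : M.carrier) : Ideal (A g) where
  carrier := {a | a • m = 0}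
  add_mem' ha hb := by
    rw [Set.mem_ofPred_eq] at *
    rw [add_smul, ha, hb, add_zero]
  zero_mem' := zero_smul _ m
  smul_mem' c a ha := by
    rw [Set.mem_ofPred_eq] at *
    rw [smul_eq_mul, mul_smul, ha, smul_zero]

/-- `𝓛_g`, the collection of the left ideals `Ann_{A(g)}(m)` for `m` in a `g`-twisted
`V`-module. -/
def annihilators (g : VOAut V) : Set (Ideal (A g)) :=
  {J | ∃ (M : TwistedModule g) (m : M.carrier), J = M.ann m}

/-- The submodule `𝓕(X) = {x ∈ X | J x = 0 for some J ∈ 𝓛_g}` of an `A(g)`-module `X`. -/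
def continuousPart (g : VOAut V) (X : Type*) [AddCommGroup X] [Module (A g) X] :
    Submodule (A g) X where
  carrier := {x | ∃ J ∈ annihilators g, ∀ a ∈ J, a • x = 0}
  zero_mem' := ⟨_, ⟨.zero g, 0, rfl⟩, fun _ _ => smul_zero _⟩
  add_mem' := by
    rintro x y ⟨_, ⟨M, m, rfl⟩, hx⟩ ⟨_, ⟨M', m', rfl⟩, hy⟩
    refine ⟨_, ⟨M.prod M', (m, m'), rfl⟩, fun a ha => ?_⟩
    have h1 := TwistedModule.smul_map (M := M.prod M') (M' := M)
      (LinearMap.fst ℂ M.carrier M'.carrier) (fun _ _ _ => rfl) a (m, m')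
    have h2 := TwistedModule.smul_map (M := M.prod M') (M' := M')
      (LinearMap.snd ℂ M.carrier M'.carrier) (fun _ _ _ => rfl) a (m, m')
    have ha' : a • (show (M.prod M').carrier from (m, m')) = 0 := ha
    rw [ha'] at h1 h2
    rw [smul_add, hx a h1.symm, hy a h2.symm, add_zero]
  smul_mem' := by
    rintro b x ⟨_, ⟨M, m, rfl⟩, hx⟩
    refine ⟨_, ⟨M, b • m, rfl⟩, fun a ha => ?_⟩
    rw [← mul_smul]
    refine hx _ ?_
    have ha' : a • b • m = 0 := ha
    exact (mul_smul a b m).trans ha'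

/-! ### Induction from `V^0` to `V` -/

/-- The embedding of affinizations. -/
def affinizationMap (g : VOAut V) :
    affinization (1 : VOAut (fixed g)) →ₗ[ℂ] affinization g :=
  (Finsupp.mapRange.linearMap (fixed g).subtype).restrict (by
    intro x hx
    induction hx using Submodule.span_induction with
    | mem x hx =>
      obtain ⟨r, n, v, -, ⟨k, hk⟩, rfl⟩ := hx
      refine Submodule.subset_span ⟨0, n, v, mem_eig_zero v.2, ⟨r + k, ?_⟩, by simp⟩
      simp only [hk, orderOf_one]
      push_cast
      ring
    | zero => rw [map_zero]; exact Submodule.zero_mem _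
    | add x y _ _ hx hy => rw [map_add]; exact Submodule.add_mem _ hx hy
    | smul c x _ hx => rw [map_smul]; exact Submodule.smul_mem _ c hx)

/-- The homomorphism `T(V̄^0) → T(V̄)`. -/
def psiT (g : VOAut V) : TensorAlgebra ℂ (affinization (1 : VOAut (fixed g))) →ₐ[ℂ]
    TensorAlgebra ℂ (affinization g) :=
  TensorAlgebra.lift ℂ ((TensorAlgebra.ι ℂ).comp (affinizationMap g))

theorem rhoT_psiT {g : VOAut V} (M : TwistedModule g)
    (x : TensorAlgebra ℂ (affinization (1 : VOAut (fixed g)))) :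
    M.rhoT (psiT g x) = M.res.rhoT x := by
  have h : M.rhoT.comp (psiT g) = M.res.rhoT := by
    refine TensorAlgebra.hom_ext (LinearMap.ext fun y => ?_)
    have h1 : psiT g (TensorAlgebra.ι ℂ y) = TensorAlgebra.ι ℂ (affinizationMap g y) :=
      TensorAlgebra.lift_ι_apply _ _
    have h2 : Finsupp.lsum ℂ M.mode (affinizationMap g y : ℚ →₀ V) =
        Finsupp.lsum ℂ M.res.mode (y : ℚ →₀ fixed g) := by
      change Finsupp.lsum ℂ M.mode (Finsupp.mapRange.linearMap (fixed g).subtype y.1) = _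
      exact Finsupp.sum_mapRange_index (hf := map_zero _) (by simp)
    exact (congrArg M.rhoT h1).trans ((M.rhoT_ι _).trans (h2.trans (M.res.rhoT_ι y).symm))
  exact DFunLike.congr_fun h x

/-- The homomorphism `ψ : U(V^0) → U_g(V)`. -/
def psiU (g : VOAut V) : EnvAlg (1 : VOAut (fixed g)) →ₐ[ℂ] EnvAlg g :=
  Ideal.Quotient.liftₐ (kerIdeal (1 : VOAut (fixed g))) ((EnvAlg.mk g).comp (psiT g))
    fun x hx => EnvAlg.mk_eq_zero.2 fun M => (rhoT_psiT M x).trans (hx M.res)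

theorem psiU_mk (g : VOAut V) (x : TensorAlgebra ℂ (affinization (1 : VOAut (fixed g)))) :
    psiU g (EnvAlg.mk _ x) = EnvAlg.mk g (psiT g x) := rfl

theorem rho_psiU {g : VOAut V} (M : TwistedModule g) (x : EnvAlg (1 : VOAut (fixed g))) :
    M.rho (psiU g x) = M.res.rho x := by
  obtain ⟨x, rfl⟩ := EnvAlg.mk_surjective _ x
  exact rhoT_psiT M x

theorem affinizationMap_grade {g : VOAut V} {μ : ℚ} {x : affinization (1 : VOAut (fixed g))}
    (hx : x ∈ affinizationGrade _ μ) : affinizationMap g x ∈ affinizationGrade g μ := by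
  induction hx using Submodule.span_induction with
  | mem x hx =>
    obtain ⟨r, k, n, v, -, hv, ⟨l, hl⟩, hμ, hx⟩ := hx
    refine Submodule.subset_span ⟨0, k, n, v, mem_eig_zero v.2, coe_mem_homogeneous hv,
      ⟨r + l, ?_⟩, hμ, ?_⟩
    · simp only [hl, orderOf_one]
      push_cast
      ring
    · change Finsupp.mapRange.linearMap (fixed g).subtype x.1 = _
      rw [hx]
      simp
  | zero => rw [map_zero]; exact Submodule.zero_mem _
  | add x y _ _ hx hy => rw [map_add]; exact Submodule.add_mem _ hx hy
  | smul c x _ hx => rw [map_smul]; exact Submodule.smul_mem _ c hx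

theorem psiT_monomial {g : VOAut V} {μ : ℚ}
    {x : TensorAlgebra ℂ (affinization (1 : VOAut (fixed g)))} (hx : IsMonomial _ μ x) :
    IsMonomial g μ (psiT g x) := by
  induction hx with
  | one => rw [map_one]; exact .one
  | mul h _ ih =>
    rw [map_mul, psiT, TensorAlgebra.lift_ι_apply]
    exact .mul (affinizationMap_grade h) ih

theorem psiU_grade {g : VOAut V} {μ : ℚ} {x : EnvAlg (1 : VOAut (fixed g))}
    (hx : x ∈ envGrade _ μ) : psiU g x ∈ envGrade g μ := by
  obtain ⟨y, hy, rfl⟩ := hx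
  refine ⟨psiT g y, ?_, rfl⟩
  have h : tensorGrade (1 : VOAut (fixed g)) μ ≤ (tensorGrade g μ).comap (psiT g).toLinearMap :=
    Submodule.span_le.2 fun z hz => Submodule.subset_span (psiT_monomial hz)
  exact h hy

/-- The homomorphism `ψ[X] : U(V^0)[[X]] → U_g(V)[[X]]`. -/
def psiX (g : VOAut V) : PowerSeries (EnvAlg (1 : VOAut (fixed g))) →ₐ[ℂ]
    PowerSeries (EnvAlg g) :=
  { PowerSeries.map (psiU g).toRingHom with
    commutes' := fun c => by
      ext i
      change psiU g (PowerSeries.coeff i (algebraMap ℂ _ c)) = _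
      rcases Nat.eq_zero_or_pos i with rfl | hi
      · rw [TwistedModule.coeff_algebraMap_zero, TwistedModule.coeff_algebraMap_zero,
          AlgHom.commutes]
      · rw [TwistedModule.coeff_algebraMap c hi, TwistedModule.coeff_algebraMap c hi, map_zero] }

theorem coeff_psiX (g : VOAut V) (i : ℕ) (f : PowerSeries (EnvAlg (1 : VOAut (fixed g)))) :
    PowerSeries.coeff i (psiX g f) = psiU g (PowerSeries.coeff i f) := rfl

theorem psiX_mem {g : VOAut V} {f : PowerSeries (EnvAlg (1 : VOAut (fixed g)))}
    (hf : f ∈ seriesAlg (1 : VOAut (fixed g))) : psiX g f ∈ seriesAlg g := by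
  refine ⟨?_, fun M m => ?_⟩
  · have h : gradedSeries (1 : VOAut (fixed g)) ≤
        (gradedSeries g).comap (psiX g).toLinearMap :=
      iSup_le fun μ x hx => Submodule.mem_iSup_of_mem μ fun i => psiU_grade (hx i)
    exact h hf.1
  · obtain ⟨N, hN⟩ := hf.2 M.res m
    exact ⟨N, fun i hi => by rw [coeff_psiX, rho_psiU]; exact hN i hi⟩

/-- The homomorphism from the algebra `C` of `V^0` to the algebra `C` of `(V, g)`. -/
def psiC (g : VOAut V) : seriesAlg (1 : VOAut (fixed g)) →ₐ[ℂ] seriesAlg g :=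
  ((psiX g).comp (seriesAlg _).val).codRestrict (seriesAlg g) fun f => psiX_mem f.2

theorem actC_psiC {g : VOAut V} (M : TwistedModule g) (f : seriesAlg (1 : VOAut (fixed g))) :
    M.actC (psiC g f) = M.res.actC f := by
  ext m
  refine finsum_congr fun i => ?_
  exact DFunLike.congr_fun (rho_psiU M (PowerSeries.coeff i f.1)) m

/-- The homomorphism `ψ̄ : A(1) → A(g)` of the algebras attached to `(V^0, 1)` and `(V, g)`. -/
def psi (g : VOAut V) : A (1 : VOAut (fixed g)) →ₐ[ℂ] A g :=
  Ideal.Quotient.liftₐ (annIdeal (1 : VOAut (fixed g))) ((A.mk g).comp (psiC g))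
    fun f hf => A.mk_eq_zero.2 fun M => (actC_psiC M f).trans (hf M.res)

/-- The group `Hom_{A(1)}(A(g), N)` for an `A(1)`-module `N`, where `A(1)` is the algebra attached
to `(V^0, 1)`, acting on `A(g)` from the left through `ψ̄`. -/
def HomSpace (g : VOAut V) (N : Type*) [AddCommGroup N] [Module (A (1 : VOAut (fixed g))) N] :
    AddSubgroup (A g →+ N) where
  carrier := {f | ∀ a x, f (psi g a * x) = a • f x}
  add_mem' ha hb := fun a x => by
    rw [AddMonoidHom.add_apply, AddMonoidHom.add_apply, ha, hb, smul_add]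
  zero_mem' := fun _ _ => by simp
  neg_mem' ha := fun a x => by
    rw [AddMonoidHom.neg_apply, AddMonoidHom.neg_apply, ha, smul_neg]

/-- The left `A(g)`-module structure `(a f)(x) = f(x a)` on `Hom_{A(1)}(A(g), N)`. -/
instance (g : VOAut V) (N : Type*) [AddCommGroup N] [Module (A (1 : VOAut (fixed g))) N] :
    Module (A g) (HomSpace g N) where
  smul a f := ⟨f.1.comp (AddMonoidHom.mulRight a), fun b x => by
    change f.1 (psi g b * x * a) = b • f.1 (x * a)
    rw [mul_assoc]
    exact f.2 b (x * a)⟩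
  one_smul f := Subtype.ext (AddMonoidHom.ext fun x => congrArg f.1 (mul_one x))
  mul_smul a b f := Subtype.ext (AddMonoidHom.ext fun x => congrArg f.1 (mul_assoc x a b).symm)
  smul_zero _ := rfl
  smul_add _ _ _ := rfl
  add_smul a b f := Subtype.ext (AddMonoidHom.ext fun x =>
    (congrArg f.1 (mul_add x a b)).trans (map_add f.1 _ _))
  zero_smul f := Subtype.ext (AddMonoidHom.ext fun x =>
    (congrArg f.1 (mul_zero x)).trans (map_zero f.1))

/-- The induced module `Ind N = 𝓕(Hom_{A(1)}(A(g), N))` of a `V^0`-module `N`. -/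
abbrev Ind (g : VOAut V) (N : TwistedModule (1 : VOAut (fixed g))) : Type u :=
  continuousPart g (HomSpace g N.carrier)

/-- The category `𝓒_g` of `g`-twisted `V`-modules is semisimple. -/
def IsSemisimpleCat (g : VOAut V) : Prop :=
  ∀ M : TwistedModule g, M.IsCompletelyReducible

/-- `𝓒_g` has only finitely many simple modules, up to isomorphism. -/
def HasFinitelyManySimples (g : VOAut V) : Prop :=
  ∃ (n : ℕ) (S : Fin n → TwistedModule g), ∀ M : TwistedModule g, M.IsSimple → ∃ i, M.Iso (S i)

end VOA

end TwistedVOA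

end

open TwistedVOA

noncomputable section

namespace TwistedVOA

/-! ### Linear algebra -/

/-! Frobenius reciprocity carries the proof. Sending `f` to `m ↦ (a ↦ f (a m))`, with evaluation at
`1` as inverse, identifies the `V^0`-homomorphisms `M → N` with the `A(g)`-homomorphisms `M → Ind
N`, for every twisted module `M` (`toInd`, `exists_eq_toInd`). The functor `𝓕` ensures that such
homomorphisms reach every element: if `Ann(m)` kills `x ∈ Ind N`, then `a m ↦ a x` is a well-defined
map on `A(g) m` with `x` in its image, and `A(g) m` is a sum of simple twisted modules by
semisimplicity. So `Ind N` is the sum of the images of simple twisted modules `S`, each image coming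
from a `V^0`-homomorphism `S → N`.

It remains to understand these homomorphisms. By associativity, a nonzero weight vector `w` of a
simple `M` generates it already through the vectors `v_n w`. Comparing degrees, the vectors whose
weight differs from that of `w` by an integer are obtained with `v ∈ V^0` alone (`mem_of_isSimple`).
This has several consequences.

A nonzero `V^0`-map from `S` to a simple `N` is an isomorphism on one component
(`exists_isoComponent`), so `Ind N = 0` if `N` is no component. If `f : S → M` is a `V^0`-map of
simple twisted modules with `f w ≠ 0`, then the submodule of `S ⊕ M` generated by `(w, f w)` does
not contain `(0, f w)`, so by Goursat's argument it is the graph of an isomorphism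
(`exists_equiv_of_res_hom`). Together with Schur's lemma this gives `dim Hom(M, N) = 1` when `N ≅
M^r` (`exists_eq_smul_of_isoComponent`). Then `Ind N` is the image of the single simple module `M`.

For arbitrary `N`, a `V^0`-map on a simple `M` is determined by its values on at most `K` weight
vectors, so `Hom(M, N)` is finite-dimensional (`finiteDimensional_homs_res`). With finitely many
simple modules, `Ind N` is thus a quotient of one twisted module, hence by semisimplicity isomorphic
to a submodule of it. -/

theorem mem_of_sum_mem_of_mem_eigenspace {E : Type*} [AddCommGroup E] [Module ℂ E]
    {f : Module.End ℂ E} {W : Submodule ℂ E} (hW : ∀ x ∈ W, f x ∈ W) (s : Finset ℂ) :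
    ∀ x : ℂ → E, (∀ c, x c ∈ f.eigenspace c) → ∑ c ∈ s, x c ∈ W → ∀ c ∈ s, x c ∈ W := by
  classical
  induction s using Finset.induction_on with
  | empty => simp
  | insert a s ha ih =>
    intro x hx hs
    have h1 : ∀ c ∈ s, x c ∈ W := by
      -- Applying `f - a` to the sum removes the term at `a` and multiplies every other term by the
      -- nonzero number `c - a`.
      have h2 := ih (fun c => (c - a) • x c) (fun c => Submodule.smul_mem _ _ (hx c)) (by
        have h3 := W.sub_mem (hW _ hs) (W.smul_mem a hs)
        rw [map_sum, Finset.smul_sum, ← Finset.sum_sub_distrib, Finset.sum_insert ha,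
          Module.End.mem_eigenspace_iff.1 (hx a), sub_self, zero_add] at h3
        convert h3 using 2 with c hc
        rw [Module.End.mem_eigenspace_iff.1 (hx c), sub_smul])
      intro c hc
      have hca : c - a ≠ 0 := sub_ne_zero.2 fun h => ha (h ▸ hc)
      simpa [smul_smul, inv_mul_cancel₀ hca] using W.smul_mem (c - a)⁻¹ (h2 c hc)
    intro c hc
    rcases Finset.mem_insert.1 hc with rfl | hc
    · rw [Finset.sum_insert ha] at hs
      exact (W.add_mem_iff_left (W.sum_mem h1)).1 hs
    · exact h1 c hc

/-- A stable subspace is spanned by the eigenvectors in it. -/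
theorem mem_iSup_inf_eigenspace {E : Type*} [AddCommGroup E] [Module ℂ E]
    {f : Module.End ℂ E} (hf : ⨆ c, f.eigenspace c = ⊤) {W : Submodule ℂ E}
    (hW : ∀ x ∈ W, f x ∈ W) {x : E} (hx : x ∈ W) : x ∈ ⨆ c, W ⊓ f.eigenspace c := by
  classical
  have hx' : x ∈ ⨆ c, f.eigenspace c := hf ▸ Submodule.mem_top
  obtain ⟨y, hy⟩ := (Submodule.mem_iSup_iff_exists_dfinsupp' _ _).1 hx'
  have hy' : ∑ c ∈ y.support, (y c : E) = x := hy
  rw [← hy']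
  exact Submodule.sum_mem _ fun c hc => Submodule.mem_iSup_of_mem c
    ⟨mem_of_sum_mem_of_mem_eigenspace hW y.support (fun c => (y c : E)) (fun c => (y c).2)
      (hy'.symm ▸ hx) c hc, (y c).2⟩

/-- Applied to the graded pieces of a cyclic submodule inside the weight spaces: a vector of the
submodule that has a given weight comes from the piece of the corresponding degree. -/
theorem mem_of_mem_iSup_of_mem {E ι : Type*} [AddCommGroup E] [Module ℂ E]
    {p q : ι → Submodule ℂ E} (hpq : ∀ i, p i ≤ q i) (hq : iSupIndep q) {i : ι} {x : E}
    (hx : x ∈ ⨆ j, p j) (hxi : x ∈ q i) : x ∈ p i := by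
  have h : (⨆ j, p j) ≤ p i ⊔ ⨆ (j) (_ : j ≠ i), q j := by
    refine iSup_le fun j => ?_
    by_cases hj : j = i
    · exact hj ▸ le_sup_left
    · exact le_sup_of_le_right (le_trans (hpq j) (le_iSup₂_of_le j hj le_rfl))
  obtain ⟨a, ha, y, hy, rfl⟩ := Submodule.mem_sup.1 (h hx)
  have hy' : y ∈ q i := (Submodule.add_mem_iff_right _ (hpq i ha)).1 hxi
  have : y = 0 := (Submodule.disjoint_def.1 (hq i)) y hy' hy
  rwa [this, add_zero]

/-- An operator of finite order is diagonalizable on every stable subspace. -/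
theorem mem_span_eigenvectors_of_pow_eq_one {E : Type*} [AddCommGroup E] [Module ℂ E]
    {G : Module.End ℂ E} {K : ℕ} (hK : 0 < K) (hG : G ^ K = 1) {W : Submodule ℂ E}
    (hW : ∀ x ∈ W, G x ∈ W) {x : E} (hx : x ∈ W) :
    x ∈ Submodule.span ℂ {y | y ∈ W ∧
      ∃ r : ℤ, y ∈ G.eigenspace (Complex.exp (2 * Real.pi * Complex.I * r / K))} := by
  have hK' : (K : ℂ) ≠ 0 := Nat.cast_ne_zero.2 hK.ne'
  set ζ : ℂ := Complex.exp (2 * Real.pi * Complex.I / K) with hζ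
  have hprim : IsPrimitiveRoot ζ K := Complex.isPrimitiveRoot_exp K hK.ne'
  have hζ0 : ζ ≠ 0 := Complex.exp_ne_zero _
  have hζK : ∀ r : ℕ, (ζ⁻¹ ^ r) ^ K = 1 := fun r => by
    rw [← pow_mul, mul_comm, pow_mul, inv_pow, hprim.pow_eq_one, inv_one, one_pow]
  have hζr : ∀ r : ℕ, Complex.exp (2 * Real.pi * Complex.I * (r : ℤ) / K) = ζ ^ r := by
    intro r
    rw [hζ, ← Complex.exp_nat_mul]
    congr 1
    push_cast
    ring
  have hWj : ∀ j : ℕ, (G ^ j) x ∈ W := by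
    intro j
    induction j with
    | zero => simpa using hx
    | succ j ih => rw [pow_succ', Module.End.mul_apply]; exact hW _ ih
  -- `P r` is `K` times the projection of `x` to the `ζ^r`-eigenspace, by discrete Fourier
  -- transform.
  let P : ℕ → E := fun r => ∑ j ∈ Finset.range K, (ζ⁻¹ ^ r) ^ j • (G ^ j) x
  have hP : ∀ r, G (P r) = ζ ^ r • P r := by
    intro r
    have h1 : G (P r) = ζ ^ r • ∑ j ∈ Finset.range K, (ζ⁻¹ ^ r) ^ (j + 1) • (G ^ (j + 1)) x := by
      rw [map_sum, Finset.smul_sum]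
      refine Finset.sum_congr rfl fun j _ => ?_
      rw [map_smul, smul_smul, pow_succ' G, Module.End.mul_apply]
      congr 1
      have : ζ ^ r ≠ 0 := pow_ne_zero _ hζ0
      rw [pow_succ, inv_pow]
      field_simp
    rw [h1]
    congr 1
    -- The sum over `0, …, K` is split at either end; the two end terms agree because `G ^ K = 1`
    -- and `ζ^{-rK} = 1`.
    have h2 := Finset.sum_range_succ (fun j => (ζ⁻¹ ^ r) ^ j • (G ^ j) x) K
    rw [Finset.sum_range_succ', hG, hζK] at h2
    simpa [P] using h2
  have hsum : ∑ r ∈ Finset.range K, P r = (K : ℂ) • x := by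
    simp only [P]
    rw [Finset.sum_comm]
    simp_rw [← Finset.sum_smul]
    -- For `0 < j < K` the number `ζ^{-j}` is a `K`-th root of unity other than `1`, so its
    -- geometric sum over `r` vanishes.
    rw [Finset.sum_eq_single 0]
    · simp
    · intro j hj hj0
      have h1 : (ζ⁻¹ ^ j) ≠ 1 := by
        rw [inv_pow, Ne, inv_eq_one]
        intro h
        exact hj0 (Nat.eq_zero_of_dvd_of_lt ((hprim.pow_eq_one_iff_dvd j).1 h)
          (Finset.mem_range.1 hj))
      have h2 : ∑ r ∈ Finset.range K, (ζ⁻¹ ^ r) ^ j = 0 := by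
        simp_rw [← pow_mul, mul_comm _ j, pow_mul]
        have h3 := geom_sum_mul (ζ⁻¹ ^ j) K
        rw [hζK, sub_self] at h3
        exact (mul_eq_zero.1 h3).resolve_right (sub_ne_zero.2 h1)
      rw [h2, zero_smul]
    · intro h
      exact absurd (Finset.mem_range.2 hK) h
  have hx' : x = (K : ℂ)⁻¹ • ∑ r ∈ Finset.range K, P r := by
    rw [hsum, smul_smul, inv_mul_cancel₀ hK', one_smul]
  rw [hx']
  refine Submodule.smul_mem _ _ (Submodule.sum_mem _ fun r _ => Submodule.subset_span ⟨?_, r, ?_⟩)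
  · exact Submodule.sum_mem _ fun j _ => W.smul_mem _ (hWj j)
  · rw [Module.End.mem_eigenspace_iff, hζr, hP]

variable {V : Type u} [AddCommGroup V] [Module ℂ V] [VertexOperatorAlgebra V] {g : VOAut V}

/-! ### Homogeneous elements of `V` -/

theorem map_mem_homogeneous (g : VOAut V) {k : ℤ} {v : V} (hv : v ∈ homogeneous V k) :
    (g : V ≃ₗ[ℂ] V) v ∈ homogeneous V k := by
  rw [homogeneous, Module.End.mem_eigenspace_iff] at *
  have h := congrArg (g : V ≃ₗ[ℂ] V) hv
  rw [g.2.1, g.2.2.2, map_smul] at h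
  exact h

/-- Since `g` fixes `ω`, it preserves each `V_k`, and having finite order it is diagonalizable
there. -/
theorem span_eig_homogeneous (hg : IsOfFinOrder g) :
    Submodule.span ℂ {v | ∃ r k : ℤ, v ∈ eig g r ∧ v ∈ homogeneous V k} = ⊤ := by
  rw [eq_top_iff, ← VertexOperatorAlgebra.grading (V := V)]
  refine iSup_le fun k v hv => ?_
  have hG : ((g : V ≃ₗ[ℂ] V) : Module.End ℂ V) ^ orderOf g = 1 := by
    have h : ∀ (n : ℕ) (x : V), (((g : V ≃ₗ[ℂ] V) : Module.End ℂ V) ^ n) x =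
        ((g ^ n : VOAut V) : V ≃ₗ[ℂ] V) x := by
      intro n
      induction n with
      | zero => intro x; rfl
      | succ n ih => intro x; rw [pow_succ, pow_succ, Module.End.mul_apply, ih]; rfl
    ext x
    rw [h, pow_orderOf_eq_one]
    rfl
  refine Submodule.span_mono ?_ (mem_span_eigenvectors_of_pow_eq_one hg.orderOf_pos hG
    (W := homogeneous V k) (fun x hx => map_mem_homogeneous g hx) hv)
  rintro y ⟨hy, r, hr⟩
  exact ⟨r, k, hr, hy⟩

theorem mem_fixed_of_dvd {r : ℤ} (hr : (orderOf g : ℤ) ∣ r) {v : V} (hv : v ∈ eig g r)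
    (hg : IsOfFinOrder g) : v ∈ fixed g := by
  obtain ⟨l, rfl⟩ := hr
  have hK' : (orderOf g : ℂ) ≠ 0 := Nat.cast_ne_zero.2 hg.orderOf_pos.ne'
  have h : Complex.exp (2 * Real.pi * Complex.I * ((orderOf g * l : ℤ) : ℂ) / orderOf g) = 1 := by
    rw [Complex.exp_eq_one_iff]
    refine ⟨l, ?_⟩
    push_cast
    field_simp
  rw [eig, h, Module.End.mem_eigenspace_iff, one_smul] at hv
  exact mem_fixed.2 hv

namespace TwistedModule

/-! ### Modes and weights -/

theorem conf_mode_comm (M : TwistedModule g) (v : V) (w : M.carrier) (t : ℚ) :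
    M.mode 1 VertexOperatorAlgebra.conf (M.mode t v w)
      - M.mode t v (M.mode 1 VertexOperatorAlgebra.conf w) =
    M.mode (1 + t) (VertexOperatorAlgebra.mode 0 VertexOperatorAlgebra.conf v) w
      + M.mode t (VertexOperatorAlgebra.mode 1 VertexOperatorAlgebra.conf v) w := by
  have hconf : (VertexOperatorAlgebra.conf : V) ∈ eig g 0 := mem_eig_zero g.2.2.2
  -- With `p = 0` and `s = 1` the Jacobi identity is the commutator formula for `L(0) = ω_1`. Only
  -- `m = 0` survives on the left and `m = 0, 1` on the right, hence `N ≥ 2`.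
  obtain ⟨N, hN, hN2⟩ := ((M.jacobi 0 _ hconf v w 0 1 t ⟨1, by simp⟩).and
    (eventually_ge_atTop 2)).exists
  obtain ⟨N, rfl⟩ := Nat.exists_eq_add_of_le' hN2
  rw [Finset.sum_range_succ', Finset.sum_range_succ', Finset.sum_eq_zero,
    Finset.sum_range_succ', Finset.sum_range_succ', Finset.sum_eq_zero] at hN
  · rw [add_comm (M.mode (1 + t) _ w)]
    simpa [Ring.choose_one_right] using hN
  · intro m _
    have : Ring.choose (((1 : ℚ)) : ℂ) (m + 1 + 1) = 0 := by
      have h := Ring.choose_natCast (R := ℂ) 1 (m + 1 + 1)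
      rw [Nat.choose_eq_zero_of_lt (by omega)] at h
      simpa using h
    rw [this, zero_smul]
  · intro m _
    have : Ring.choose (((0 : ℤ)) : ℂ) (m + 1 + 1) = 0 := by
      rw [Int.cast_zero, Ring.choose_zero_succ]
    rw [this, mul_zero, zero_smul]

/-- In the commutator formula for `L(0)`, the derivative property turns `(L(-1)v)_{n+1}` into
`-(n+1) v_n`, while `(L(0)v)_n = k v_n`. -/
theorem mode_mem_weightSpace (M : TwistedModule g) {k : ℤ} {v : V} (hv : v ∈ homogeneous V k)
    {c : ℂ} {w : M.carrier} (hw : w ∈ M.weightSpace c) (n : ℚ) :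
    M.mode n v w ∈ M.weightSpace (c + ((k - n - 1 : ℚ) : ℂ)) := by
  have h := M.conf_mode_comm v w n
  rw [homogeneous, Module.End.mem_eigenspace_iff] at hv
  rw [weightSpace, Module.End.mem_eigenspace_iff] at *
  rw [hv, hw, M.derivative, map_smul, map_smul, sub_eq_iff_eq_add, add_sub_cancel_left,
    LinearMap.smul_apply, ← add_smul, ← add_smul] at h
  rw [h]
  congr 1
  push_cast
  ring

theorem weightSpace_iSupIndep (M : TwistedModule g) : iSupIndep M.weightSpace :=
  Module.End.eigenspaces_iSupIndep _

/-- The vectors `v_n w` with `v` and `w` homogeneous and `deg v_n = j / K`. -/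
def cyclicGrade (M : TwistedModule g) (w : M.carrier) (j : ℤ) : Submodule ℂ M.carrier :=
  Submodule.span ℂ {x | ∃ (r k : ℤ) (n : ℚ) (v : V), v ∈ eig g r ∧ v ∈ homogeneous V k ∧
    modeIndex g r n ∧ (k : ℚ) - n - 1 = j / orderOf g ∧ x = M.mode n v w}

theorem cyclicGrade_le_weightSpace (M : TwistedModule g) {c : ℂ} {w : M.carrier}
    (hw : w ∈ M.weightSpace c) (j : ℤ) :
    M.cyclicGrade w j ≤ M.weightSpace (c + j / orderOf g) := by
  refine Submodule.span_le.2 ?_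
  rintro _ ⟨r, k, n, v, -, hk, -, h, rfl⟩
  have := M.mode_mem_weightSpace hk hw n
  rw [h] at this
  simpa using this

/-- Reduces statements about all `v_n w` to homogeneous eigenvectors `v ∈ V^r` with `n ∈ r/K + ℤ`;
the other modes of `v ∈ V^r` vanish. -/
theorem mode_mem_of_homogeneous (hg : IsOfFinOrder g) (M : TwistedModule g) (w : M.carrier)
    (n : ℚ) (W : Submodule ℂ M.carrier)
    (h : ∀ (r k : ℤ) (v : V), v ∈ eig g r → v ∈ homogeneous V k → modeIndex g r n →
      M.mode n v w ∈ W) (v : V) : M.mode n v w ∈ W := by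
  have hle : Submodule.span ℂ {v | ∃ r k : ℤ, v ∈ eig g r ∧ v ∈ homogeneous V k} ≤
      W.comap ((M.mode n).flip w) := by
    refine Submodule.span_le.2 ?_
    rintro v ⟨r, k, hr, hk⟩
    by_cases hn : modeIndex g r n
    · exact h r k v hr hk hn
    · change M.mode n v w ∈ W
      rw [M.mode_support r v hr n hn]
      exact W.zero_mem
  rw [span_eig_homogeneous hg] at hle
  exact hle Submodule.mem_top

theorem mode_mem_iSup_cyclicGrade (hg : IsOfFinOrder g) (M : TwistedModule g) (w : M.carrier)
    (n : ℚ) (v : V) : M.mode n v w ∈ ⨆ j, M.cyclicGrade w j := by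
  refine M.mode_mem_of_homogeneous hg w n _ (fun r k v hr hk hn => ?_) v
  obtain ⟨l, hl⟩ := hn
  -- For `n = r/K + l` the degree `k - n - 1` equals `(K(k - 1 - l) - r)/K`.
  refine Submodule.mem_iSup_of_mem (orderOf g * (k - 1 - l) - r)
    (Submodule.subset_span ⟨r, k, n, v, hr, hk, ⟨l, hl⟩, ?_, rfl⟩)
  have hK : (orderOf g : ℚ) ≠ 0 := Nat.cast_ne_zero.2 hg.orderOf_pos.ne'
  rw [hl]
  push_cast
  field_simp
  ring

theorem self_mem_iSup_cyclicGrade (hg : IsOfFinOrder g) (M : TwistedModule g) (w : M.carrier) :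
    w ∈ ⨆ j, M.cyclicGrade w j := by
  have h := M.mode_mem_iSup_cyclicGrade hg w (-1) VertexOperatorAlgebra.vac
  rwa [M.vac_mode, if_pos rfl] at h

/-- Products `u_s v_t w` are linear combinations of vectors `x_n w`. -/
theorem mode_mode_mem_span (hg : IsOfFinOrder g) (M : TwistedModule g) (u v : V) (s t : ℚ)
    (w : M.carrier) : M.mode s u (M.mode t v w) ∈
      Submodule.span ℂ {x | ∃ (n : ℚ) (y : V), x = M.mode n y w} := by
  refine M.mode_mem_of_homogeneous hg _ s _ (fun r k u hr _ hs => ?_) u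
  obtain ⟨B, hB⟩ := M.truncation v w
  obtain ⟨B', hB'⟩ := M.truncation u w
  -- Induction on how far `t` lies below the bound `B` from which on `v_t w = 0`.
  have key : ∀ (i : ℕ) (s t : ℚ), modeIndex g r s → B ≤ t + i → M.mode s u (M.mode t v w) ∈
      Submodule.span ℂ {x | ∃ (n : ℚ) (y : V), x = M.mode n y w} := by
    intro i
    induction i with
    | zero =>
      intro s t _ ht
      rw [hB t (by simpa using ht), map_zero]
      exact Submodule.zero_mem _
    | succ i ih =>
      intro s t hs ht
      -- `l` is so large that `u_{s+l+m} w = 0` for all `m ≥ 0`. The Jacobi identity with `p = -l`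
      -- and `s + l` in place of `s` then loses its second half. On the left, `m = 0` gives `u_s v_t
      -- w`, while the terms `u_{s-m} v_{t+m} w` with `m ≥ 1` are covered by induction; the right
      -- side is a combination of vectors `x_n w`.
      obtain ⟨l, hl⟩ := exists_nat_ge (B' - s)
      have hs' : ∀ m : ℕ, modeIndex g r (s - m) := by
        obtain ⟨q, hq⟩ := hs
        exact fun m => ⟨q - m, by rw [hq]; push_cast; ring⟩
      have hsl : modeIndex g r (s + l) := by
        obtain ⟨q, hq⟩ := hs
        exact ⟨q + l, by rw [hq]; push_cast; ring⟩
      obtain ⟨N, hN, hN1⟩ := ((M.jacobi r u hr v w (-(l : ℤ)) (s + l) t hsl).and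
        (eventually_ge_atTop 1)).exists
      obtain ⟨N, rfl⟩ := Nat.exists_eq_add_of_le' hN1
      have hR : ∑ m ∈ Finset.range (N + 1), Ring.choose (((s + l : ℚ)) : ℂ) m •
          M.mode (s + l + t - m) (VertexOperatorAlgebra.mode (-(l : ℤ) + m) u v) w ∈
          Submodule.span ℂ {x | ∃ (n : ℚ) (y : V), x = M.mode n y w} :=
        Submodule.sum_mem _ fun m _ => Submodule.smul_mem _ _ (Submodule.subset_span ⟨_, _, rfl⟩)
      rw [← hN, Finset.sum_range_succ'] at hR
      have hz : ∀ m : ℕ, M.mode (s + l + m) u w = 0 := fun m =>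
        hB' _ (by have : (0 : ℚ) ≤ m := Nat.cast_nonneg m
                  linarith)
      have hsm : ∀ m : ℕ, ((-(l : ℤ) : ℤ) : ℚ) + (s + l) - m = s - m := fun m => by
        push_cast; ring
      simp only [hz, map_zero, smul_zero, sub_zero, hsm] at hR
      rw [Submodule.add_mem_iff_right] at hR
      · simpa using hR
      · refine Submodule.sum_mem _ fun m _ => Submodule.smul_mem _ _ (ih _ _ (hs' _) ?_)
        push_cast at ht ⊢
        have : (0 : ℚ) ≤ m := Nat.cast_nonneg m
        linarith
  obtain ⟨i, hi⟩ := exists_nat_ge (B - t)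
  exact key i s t hs (by linarith)

/-- Because a product of two modes applied to `w` reduces to single modes, no longer products are
needed to generate a submodule from `w`. -/
theorem iSup_cyclicGrade_isInvariant (hg : IsOfFinOrder g) (M : TwistedModule g)
    (w : M.carrier) : M.IsInvariant (⨆ j, M.cyclicGrade w j) := by
  intro n v x hx
  have h1 : (⨆ j, M.cyclicGrade w j) ≤
      Submodule.span ℂ {x | ∃ (n : ℚ) (y : V), x = M.mode n y w} := by
    refine iSup_le fun j => Submodule.span_mono ?_
    rintro _ ⟨r, k, n, v, -, -, -, -, rfl⟩
    exact ⟨n, v, rfl⟩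
  have h2 : Submodule.span ℂ {x | ∃ (n : ℚ) (y : V), x = M.mode n y w} ≤
      (⨆ j, M.cyclicGrade w j).comap (M.mode n v) := by
    refine Submodule.span_le.2 ?_
    rintro _ ⟨t, y, rfl⟩
    refine (Submodule.span_le (p := ⨆ j, M.cyclicGrade w j)).2 ?_
      (M.mode_mode_mem_span hg v y n t w)
    rintro _ ⟨t, y, rfl⟩
    exact M.mode_mem_iSup_cyclicGrade hg w t y
  exact h2 (h1 hx)

theorem weight_add_injective (hg : IsOfFinOrder g) (c : ℂ) :
    Function.Injective fun j : ℤ => c + (j : ℂ) / orderOf g := by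
  intro i j h
  have hK : (orderOf g : ℂ) ≠ 0 := Nat.cast_ne_zero.2 hg.orderOf_pos.ne'
  have h' := add_left_cancel h
  rw [div_left_inj' hK] at h'
  exact Int.cast_injective h'

/-- The part of integral degree of the submodule generated by a weight vector lies in the
`V^0`-submodule generated by it. -/
theorem mem_of_mem_iSup_cyclicGrade (hg : IsOfFinOrder g) (M : TwistedModule g) {c : ℂ}
    {w x : M.carrier} (hw : w ∈ M.weightSpace c) {d : ℤ} (hx : x ∈ M.weightSpace (c + d))
    (hxw : x ∈ ⨆ j, M.cyclicGrade w j) {W : Submodule ℂ M.carrier} (hwW : w ∈ W)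
    (hW : ∀ (n : ℚ) (v : fixed g), ∀ y ∈ W, M.mode n (v : V) y ∈ W) : x ∈ W := by
  have hK : (orderOf g : ℂ) ≠ 0 := Nat.cast_ne_zero.2 hg.orderOf_pos.ne'
  have hKQ : (orderOf g : ℚ) ≠ 0 := Nat.cast_ne_zero.2 hg.orderOf_pos.ne'
  have hd : c + (d : ℂ) = c + ((orderOf g * d : ℤ) : ℂ) / orderOf g := by
    push_cast
    rw [mul_div_cancel_left₀ _ hK]
  rw [hd] at hx
  have h := mem_of_mem_iSup_of_mem (M.cyclicGrade_le_weightSpace hw)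
    (M.weightSpace_iSupIndep.comp (weight_add_injective hg c)) hxw hx
  refine (Submodule.span_le (p := W)).2 ?_ h
  rintro _ ⟨r, k, n, v, hr, -, ⟨l, hl⟩, hd, rfl⟩
  -- Degree `k - n - 1 = d` with `n = r/K + l` forces `r = K(k - 1 - d - l)`, so `v` is fixed by
  -- `g`.
  refine hW n ⟨v, mem_fixed_of_dvd ⟨k - 1 - d - l, ?_⟩ hr hg⟩ w hwW
  rw [hl] at hd
  push_cast at hd
  rw [mul_div_cancel_left₀ _ hKQ] at hd
  have : (r : ℚ) = orderOf g * (k - 1 - d - l) := by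
    rw [← hd]
    field_simp
    ring
  exact_mod_cast this

theorem mem_iSup_cyclicGrade_of_isSimple (hg : IsOfFinOrder g) {M : TwistedModule g}
    (hM : M.IsSimple) {w : M.carrier} (hw : w ≠ 0) (x : M.carrier) :
    x ∈ ⨆ j, M.cyclicGrade w j := by
  rcases hM.2 _ (M.iSup_cyclicGrade_isInvariant hg w) with h | h
  · have := M.self_mem_iSup_cyclicGrade hg w
    rw [h] at this
    exact absurd this hw
  · rw [h]
    exact Submodule.mem_top

/-- What simplicity of `M` means over `V^0`: any nonzero weight vector generates all vectors whose
weight differs from its own by an integer. The components `M^r` thus behave as simple `V^0`-modules.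
-/
theorem mem_of_isSimple (hg : IsOfFinOrder g) {M : TwistedModule g} (hM : M.IsSimple) {c : ℂ}
    {w x : M.carrier} (hw0 : w ≠ 0) (hw : w ∈ M.weightSpace c) {d : ℤ}
    (hx : x ∈ M.weightSpace (c + d)) {W : Submodule ℂ M.carrier} (hwW : w ∈ W)
    (hW : ∀ (n : ℚ) (v : fixed g), ∀ y ∈ W, M.mode n (v : V) y ∈ W) : x ∈ W :=
  M.mem_of_mem_iSup_cyclicGrade hg hw hx (mem_iSup_cyclicGrade_of_isSimple hg hM hw0 x) hwW hW

/-- A weight vector of weight `c` generates `M`, and the operators `v_n` shift weights by multiples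
of `1/K`; independence of weight spaces leaves no room for other weights. -/
theorem exists_weight_eq (hg : IsOfFinOrder g) {M : TwistedModule g} (hM : M.IsSimple) {c d : ℂ}
    (hc : M.weightSpace c ≠ ⊥) (hd : M.weightSpace d ≠ ⊥) :
    ∃ j : ℤ, d = c + j / orderOf g := by
  obtain ⟨w, hw, hw0⟩ := Submodule.exists_mem_ne_zero_of_ne_bot hc
  obtain ⟨x, hx, hx0⟩ := Submodule.exists_mem_ne_zero_of_ne_bot hd
  by_contra! hne
  refine hx0 (Submodule.disjoint_def.1 (M.weightSpace_iSupIndep d) x hx ?_)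
  have h : (⨆ j, M.cyclicGrade w j) ≤ ⨆ (e) (_ : e ≠ d), M.weightSpace e :=
    iSup_le fun j => (M.cyclicGrade_le_weightSpace hw j).trans
      (le_iSup₂_of_le _ (hne j).symm le_rfl)
  exact h (mem_iSup_cyclicGrade_of_isSimple hg hM hw0 x)

theorem exists_weightSpace_ne_bot (M : TwistedModule g) [Nontrivial M.carrier] :
    ∃ c, M.weightSpace c ≠ ⊥ := by
  by_contra! h
  have h1 : ⨆ c, M.weightSpace c = ⊤ := M.grading
  simp only [h, iSup_bot] at h1
  exact bot_ne_top h1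

/-- The weights in `d + (1/K)ℤ` fall into `K` cosets of `ℤ`, each bounded below, so there is a least
one. -/
theorem exists_isMinimalWeight (hg : IsOfFinOrder g) (M : TwistedModule g)
    [Nontrivial M.carrier] : ∃ c, M.IsMinimalWeight c := by
  have hK0 : 0 < orderOf g := hg.orderOf_pos
  have hK : (orderOf g : ℂ) ≠ 0 := Nat.cast_ne_zero.2 hK0.ne'
  obtain ⟨d, hd⟩ := M.exists_weightSpace_ne_bot
  choose N hN using fun r : ℕ => M.grading_bounded (d + r / orderOf g)
  obtain ⟨j, hj, hmin⟩ := Int.exists_least_of_bdd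
    (P := fun j : ℤ => M.weightSpace (d + j / orderOf g) ≠ ⊥)
    (by
      obtain ⟨B, hB'⟩ := ((Finset.range (orderOf g)).image N).bddBelow
      have hB : ∀ r ∈ Finset.range (orderOf g), B ≤ N r := fun r hr =>
        hB' (Finset.mem_coe.2 (Finset.mem_image_of_mem N hr))
      refine ⟨orderOf g * B, fun z hz => ?_⟩
      by_contra! hlt
      refine hz ?_
      have hK1 : (0 : ℤ) < orderOf g := by exact_mod_cast hK0
      obtain ⟨r, hr⟩ := Int.eq_ofNat_of_zero_le (Int.emod_nonneg z hK1.ne')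
      have hr' : r < orderOf g := by
        have := Int.emod_lt_of_pos z hK1
        omega
      have hq : z / orderOf g < N r := lt_of_lt_of_le
        (Int.ediv_lt_of_lt_mul hK1 (by rwa [mul_comm])) (hB r (Finset.mem_range.2 hr'))
      have h1 := hN r _ hq
      -- Division of `z` by `K` with remainder `r` selects the coset whose bound applies.
      have h2 : d + (z : ℂ) / orderOf g = ((z / orderOf g : ℤ) : ℂ) + (d + r / orderOf g) := by
        have h3 : (z : ℂ) = orderOf g * ((z / orderOf g : ℤ) : ℂ) + r := by
          have h4 := Int.mul_ediv_add_emod z (orderOf g)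
          rw [hr] at h4
          exact_mod_cast h4.symm
        conv_lhs => rw [h3]
        field_simp
        ring
      rw [h2]
      exact h1)
    ⟨0, by simpa using hd⟩
  refine ⟨_, hj, fun i hi => ?_⟩
  by_contra h
  have := hmin (j - i) (by
    convert h using 3
    push_cast
    ring)
  omega

/-! ### Submodules -/

/-- A submodule of a `g`-twisted module, as a `g`-twisted module. -/
def sub (M : TwistedModule g) (W : Submodule ℂ M.carrier) (hW : M.IsInvariant W) :
    TwistedModule g where
  carrier := W
  mode n :=
    { toFun := fun v => (M.mode n v).restrict (hW n v)
      map_add' := fun _ _ => by ext; simp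
      map_smul' := fun _ _ => by ext; simp }
  mode_support r v hv n hn := by
    ext w
    simp [M.mode_support r v hv n hn]
  truncation v w := by
    obtain ⟨N, hN⟩ := M.truncation v w
    exact ⟨N, fun n hn => Subtype.ext (hN n hn)⟩
  vac_mode n w := by
    have h := M.vac_mode n (w : M.carrier)
    refine Subtype.ext (h.trans ?_)
    split_ifs <;> rfl
  jacobi r u hu v w p s t hs := by
    filter_upwards [M.jacobi r u hu v w p s t hs] with N hN
    apply Subtype.ext
    simpa using hN
  virasoro m n w := Subtype.ext (M.virasoro m n w)
  grading := by
    rw [eq_top_iff]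
    rintro x -
    -- `W` is stable under `L(0)`, hence inherits the weight decomposition.
    have h := mem_iSup_inf_eigenspace M.grading (hW 1 _) x.2
    have hle : (⨆ c, W ⊓ Module.End.eigenspace (M.mode 1 VertexOperatorAlgebra.conf) c) ≤
        (⨆ c, Module.End.eigenspace
          ((M.mode 1 VertexOperatorAlgebra.conf).restrict (hW 1 _)) c).map W.subtype := by
      refine iSup_le fun c y hy => ⟨⟨y, hy.1⟩, Submodule.mem_iSup_of_mem c ?_, rfl⟩
      exact Module.End.mem_eigenspace_iff.2 (Subtype.ext (Module.End.mem_eigenspace_iff.1 hy.2))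
    obtain ⟨y, hy, hyx⟩ := hle h
    rwa [Subtype.ext hyx] at hy
  grading_finite c := by
    have : FiniteDimensional ℂ (M.weightSpace c) := M.grading_finite c
    refine FiniteDimensional.of_injective
      (W.subtype.restrict (q := M.weightSpace c) fun x hx => ?_) ?_
    · rw [weightSpace, Module.End.mem_eigenspace_iff] at *
      exact congrArg Subtype.val hx
    · intro x y hxy
      exact Subtype.ext (Subtype.ext (congrArg (fun z : M.weightSpace c => (z : M.carrier)) hxy))
  grading_bounded c := by
    obtain ⟨N, hN⟩ := M.grading_bounded c
    refine ⟨N, fun n hn => (Submodule.eq_bot_iff _).2 fun x hx => Subtype.ext ?_⟩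
    have h : (x : M.carrier) ∈
        Module.End.eigenspace (M.mode 1 VertexOperatorAlgebra.conf) (n + c) := by
      rw [Module.End.mem_eigenspace_iff] at *
      exact congrArg Subtype.val hx
    rw [hN n hn] at h
    exact (Submodule.mem_bot ℂ).1 h
  derivative n v w := Subtype.ext (M.derivative n v w)

/-! ### The action of `A(g)` -/

/-- The operators `v_n` with `v` homogeneous lie in `A(g)`. -/
theorem exists_smul_eq_mode {r k : ℤ} {n : ℚ} {v : V} (hr : v ∈ eig g r)
    (hk : v ∈ homogeneous V k) (hn : modeIndex g r n) :
    ∃ a : A g, ∀ (M : TwistedModule g) (m : M.carrier), a • m = M.mode n v m := by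
  let x : affinization g :=
    ⟨Finsupp.single n v, Submodule.subset_span ⟨r, n, v, hr, hn, rfl⟩⟩
  let e : EnvAlg g := EnvAlg.mk g (TensorAlgebra.ι ℂ x)
  have he : e ∈ envGrade g (k - n - 1) := by
    refine ⟨TensorAlgebra.ι ℂ x, Submodule.subset_span ?_, rfl⟩
    have h := IsMonomial.mul (g := g) (μ := k - n - 1) (x := x)
      (Submodule.subset_span ⟨r, k, n, v, hr, hk, hn, rfl, rfl⟩) .one
    rwa [add_zero, mul_one] at h
  have hc : ∀ i, 1 ≤ i → PowerSeries.coeff i (PowerSeries.C e) = 0 := fun i hi => by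
    rw [PowerSeries.coeff_C, if_neg (by omega)]
  have hs : ∀ (M : TwistedModule g) (m : M.carrier) (i : ℕ), 1 ≤ i →
      M.rho (PowerSeries.coeff i (PowerSeries.C e)) m = 0 := fun M m i hi => by
    rw [hc i hi, map_zero, LinearMap.zero_apply]
  have hf : PowerSeries.C e ∈ seriesAlg g := by
    -- A constant series is homogeneous of the degree of its coefficient, and summable on every
    -- module.
    refine ⟨Submodule.mem_iSup_of_mem (k - n - 1 : ℚ) fun i => ?_, fun M m => ⟨1, hs M m⟩⟩
    rcases Nat.eq_zero_or_pos i with rfl | hi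
    · simpa using he
    · rw [hc i hi]
      exact Submodule.zero_mem _
  refine ⟨A.mk g ⟨PowerSeries.C e, hf⟩, fun M m => ?_⟩
  rw [smul_mk, M.seriesAct_eq_sum (hs M m), Finset.sum_range_one, PowerSeries.coeff_C, if_pos rfl,
    rho_mk, rhoT_ι]
  simp [x]

theorem algebraMap_smul' (M : TwistedModule g) (c : ℂ) (m : M.carrier) :
    algebraMap ℂ (A g) c • m = c • m := by
  change M.actA (algebraMap ℂ (A g) c) m = c • m
  rw [AlgHom.commutes]
  rfl

instance (M : TwistedModule g) : IsScalarTower ℂ (A g) M.carrier where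
  smul_assoc c a m := by
    rw [Algebra.smul_def, mul_smul, M.algebraMap_smul']

/-- The compatibility behind reciprocity. `M` and `M.res` have the same underlying type with actions
of different algebras, hence the type ascriptions. -/
theorem res_smul (M : TwistedModule g) (a : A (1 : VOAut (fixed g))) (m : M.carrier) :
    psi g a • m = (show M.res.carrier from a • (show M.res.carrier from m)) := by
  obtain ⟨f, rfl⟩ := A.mk_surjective _ a
  exact DFunLike.congr_fun (actC_psiC M f) m

/-- Linear maps over `A(g)` are linear over `ℂ`. -/
theorem map_complex_smul {M M' : TwistedModule g} {φ : M.carrier →+ M'.carrier}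
    (hφ : ∀ (a : A g) (m : M.carrier), φ (a • m) = a • φ m) (c : ℂ) (m : M.carrier) :
    φ (c • m) = c • φ m := by
  rw [← M.algebraMap_smul', hφ, M'.algebraMap_smul']

/-- Linear maps over `A(g)` commute with all `v_n`. -/
theorem map_mode_of_map_smul (hg : IsOfFinOrder g) {M M' : TwistedModule g}
    {φ : M.carrier →ₗ[ℂ] M'.carrier}
    (hφ : ∀ (a : A g) (m : M.carrier), φ (a • m) = a • φ m) (n : ℚ) (v : V) (m : M.carrier) :
    φ (M.mode n v m) = M'.mode n v (φ m) := by
  have hle : Submodule.span ℂ {v | ∃ r k : ℤ, v ∈ eig g r ∧ v ∈ homogeneous V k} ≤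
      LinearMap.eqLocus (φ.comp ((M.mode n).flip m)) ((M'.mode n).flip (φ m)) := by
    refine Submodule.span_le.2 ?_
    rintro v ⟨r, k, hr, hk⟩
    change φ (M.mode n v m) = M'.mode n v (φ m)
    by_cases hn : modeIndex g r n
    · obtain ⟨a, ha⟩ := exists_smul_eq_mode hr hk hn
      rw [← ha, ← ha, hφ]
    · rw [M.mode_support r v hr n hn, M'.mode_support r v hr n hn]
      simp
  rw [span_eig_homogeneous hg] at hle
  exact hle Submodule.mem_top

/-- A linear map commuting with all `v_n`, as a map of `A(g)`-modules. -/
def toLinearMapA {M M' : TwistedModule g} (φ : M.carrier →ₗ[ℂ] M'.carrier)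
    (hφ : ∀ (n : ℚ) (v : V) (m : M.carrier), φ (M.mode n v m) = M'.mode n v (φ m)) :
    M.carrier →ₗ[A g] M'.carrier :=
  { φ with map_smul' := fun a m => smul_map φ hφ a m }

/-- An `A(g)`-submodule is stable under all `v_n`. -/
theorem isInvariant_restrictScalars (hg : IsOfFinOrder g) (M : TwistedModule g)
    (T : Submodule (A g) M.carrier) : M.IsInvariant (T.restrictScalars ℂ) := by
  intro n v w hw
  refine M.mode_mem_of_homogeneous hg w n _ (fun r k v hr hk hn => ?_) v
  obtain ⟨a, ha⟩ := exists_smul_eq_mode hr hk hn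
  rw [← ha]
  exact T.smul_mem a hw

/-- A submodule of a twisted module, as an `A(g)`-submodule. -/
def submoduleA (M : TwistedModule g) (W : Submodule ℂ M.carrier) (hW : M.IsInvariant W) :
    Submodule (A g) M.carrier :=
  LinearMap.range (toLinearMapA (M := M.sub W hW) (M' := M) W.subtype fun _ _ _ => rfl)

theorem mem_submoduleA {M : TwistedModule g} {W : Submodule ℂ M.carrier} {hW : M.IsInvariant W}
    {x : M.carrier} : x ∈ M.submoduleA W hW ↔ x ∈ W := by
  constructor
  · rintro ⟨y, rfl⟩
    exact y.2
  · intro hx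
    exact ⟨⟨x, hx⟩, rfl⟩

/-- An `A(g)`-submodule of a twisted module, as a twisted module. -/
def ofSubmodule (hg : IsOfFinOrder g) (M : TwistedModule g) (T : Submodule (A g) M.carrier) :
    TwistedModule g :=
  M.sub (T.restrictScalars ℂ) (M.isInvariant_restrictScalars hg T)

/-- The identity, from `ofSubmodule` to the submodule. -/
def ofSubmoduleEquiv (hg : IsOfFinOrder g) (M : TwistedModule g) (T : Submodule (A g) M.carrier) :
    (M.ofSubmodule hg T).carrier ≃ₗ[A g] T :=
  { toFun := fun x => x
    invFun := fun x => x
    left_inv := fun _ => rfl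
    right_inv := fun _ => rfl
    map_add' := fun _ _ => rfl
    map_smul' := fun a x => Subtype.ext
      (smul_map (M := M.ofSubmodule hg T) (M' := M) (T.restrictScalars ℂ).subtype
        (fun _ _ _ => rfl) a x) }

theorem isSimple_ofSubmodule (hg : IsOfFinOrder g) (M : TwistedModule g)
    (T : Submodule (A g) M.carrier) [hT : IsSimpleModule (A g) T] :
    (M.ofSubmodule hg T).IsSimple := by
  refine ⟨?_, fun W hW => ?_⟩
  · have : Nontrivial T := IsSimpleModule.nontrivial (A g) T
    exact this
  · rcases eq_bot_or_eq_top
      (((M.ofSubmodule hg T).submoduleA W hW).map (M.ofSubmoduleEquiv hg T).toLinearMap) with h | h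
    · left
      refine (Submodule.eq_bot_iff _).2 fun x hx => ?_
      have hx' := Submodule.mem_map_of_mem (f := (M.ofSubmoduleEquiv hg T).toLinearMap)
        ((mem_submoduleA (hW := hW)).2 hx)
      rw [h] at hx'
      exact (M.ofSubmoduleEquiv hg T).map_eq_zero_iff.1 hx'
    · right
      refine eq_top_iff.2 fun x _ => ?_
      have hx : M.ofSubmoduleEquiv hg T x ∈ (⊤ : Submodule (A g) T) := Submodule.mem_top
      rw [← h] at hx
      obtain ⟨y, hy, hyx⟩ := hx
      rw [← (M.ofSubmoduleEquiv hg T).injective hyx]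
      exact mem_submoduleA.1 hy

/-- Subspaces stable under all modes are the same as `A(g)`-submodules, so the simple ones
correspond and complete reducibility carries over. -/
theorem isSemisimpleModule (hg : IsOfFinOrder g) {M : TwistedModule g}
    (hM : M.IsCompletelyReducible) : IsSemisimpleModule (A g) M.carrier := by
  obtain ⟨S, hS, -, htop⟩ := hM
  refine IsSemisimpleModule.of_sSup_simples_eq_top ?_
  have hle : sSup S ≤ (sSup {m : Submodule (A g) M.carrier |
      IsSimpleModule (A g) m}).restrictScalars ℂ := by
    refine sSup_le fun W hWS => ?_
    obtain ⟨hW, hW0, hmin⟩ := hS W hWS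
    have hsimple : IsSimpleModule (A g) (M.submoduleA W hW) := by
      rw [isSimpleModule_iff_isAtom]
      refine ⟨fun h => hW0 ?_, fun T hT => ?_⟩
      · refine (Submodule.eq_bot_iff _).2 fun x hx => ?_
        have := (mem_submoduleA (hW := hW)).2 hx
        rwa [h] at this
      · have hTW : T.restrictScalars ℂ ≤ W := fun x hx => mem_submoduleA.1 (hT.le hx)
        rcases hmin _ hTW (M.isInvariant_restrictScalars hg T) with h | h
        · exact (Submodule.restrictScalars_eq_bot_iff ℂ _ _).1 h
        · refine absurd (fun x hx => ?_) hT.not_ge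
          have hx' : x ∈ T.restrictScalars ℂ := h ▸ mem_submoduleA.1 hx
          exact hx'
    intro x hx
    exact le_sSup (a := M.submoduleA W hW) hsimple (mem_submoduleA.2 hx)
  rw [htop] at hle
  exact eq_top_iff.2 fun x _ => hle Submodule.mem_top

end TwistedModule

/-- Projections along stable complements commute with an operator. -/
theorem exists_projection {E : Type*} [AddCommGroup E] [Module ℂ E] {C D : Submodule ℂ E}
    (h : IsCompl C D) : ∃ p : E →ₗ[ℂ] C, (∀ x : C, p x = x) ∧
      ∀ T : E →ₗ[ℂ] E, (∀ x ∈ C, T x ∈ C) → (∀ x ∈ D, T x ∈ D) →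
        ∀ x, (p (T x) : E) = T (p x) := by
  refine ⟨Submodule.projectionOnto C D h, Submodule.projectionOnto_apply_left h, ?_⟩
  intro T hC hD x
  have hproj : ∀ y ∈ C, ∀ z ∈ D, (Submodule.projectionOnto C D h (y + z) : E) = y := by
    intro y hy z hz
    rw [map_add, (Submodule.projectionOnto_apply_eq_zero_iff h).2 hz, add_zero]
    exact congrArg Subtype.val (Submodule.projectionOnto_apply_left h ⟨y, hy⟩)
  obtain ⟨y, hy, z, hz, rfl⟩ := Submodule.mem_sup.1
    (h.sup_eq_top ▸ Submodule.mem_top : x ∈ C ⊔ D)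
  rw [map_add, hproj _ (hC y hy) _ (hD z hz), hproj _ hy _ hz]

namespace TwistedModule

/-! ### Simple modules -/

/-- A linear map commuting with the action of all `v_n`. -/
def IsHom {M M' : TwistedModule g} (f : M.carrier →ₗ[ℂ] M'.carrier) : Prop :=
  ∀ (n : ℚ) (v : V) (m : M.carrier), f (M.mode n v m) = M'.mode n v (f m)

theorem IsHom.comp {M M' M'' : TwistedModule g} {f : M.carrier →ₗ[ℂ] M'.carrier}
    {f' : M'.carrier →ₗ[ℂ] M''.carrier} (hf' : IsHom f') (hf : IsHom f) : IsHom (f'.comp f) :=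
  fun n v m => by rw [LinearMap.comp_apply, LinearMap.comp_apply, hf, hf']

/-- The space of homomorphisms from `M` to `M'`. -/
def homs (M M' : TwistedModule g) : Submodule ℂ (M.carrier →ₗ[ℂ] M'.carrier) where
  carrier := {f | IsHom f}
  add_mem' ha hb n v m := by
    rw [LinearMap.add_apply, LinearMap.add_apply, ha, hb, map_add]
  zero_mem' n v m := by simp
  smul_mem' c f hf n v m := by
    rw [LinearMap.smul_apply, LinearMap.smul_apply, hf, map_smul]

theorem IsHom.map_mem_weightSpace {M M' : TwistedModule g} {f : M.carrier →ₗ[ℂ] M'.carrier}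
    (hf : IsHom f) {c : ℂ} {w : M.carrier} (hw : w ∈ M.weightSpace c) :
    f w ∈ M'.weightSpace c := by
  rw [weightSpace, Module.End.mem_eigenspace_iff] at *
  rw [← hf, hw, map_smul]

theorem IsHom.isInvariant_ker {M M' : TwistedModule g} {f : M.carrier →ₗ[ℂ] M'.carrier}
    (hf : IsHom f) : M.IsInvariant (LinearMap.ker f) := by
  intro n v w hw
  rw [LinearMap.mem_ker] at *
  rw [hf, hw, map_zero]

/-- A linear map that is not zero is not zero on some weight vector. -/
theorem exists_weight_vector {M : TwistedModule g} {E : Type*} [AddCommGroup E] [Module ℂ E]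
    {f : M.carrier →ₗ[ℂ] E} (hf : f ≠ 0) : ∃ (c : ℂ) (w : M.carrier),
      w ∈ M.weightSpace c ∧ f w ≠ 0 := by
  by_contra! h
  have h1 : ⨆ c, M.weightSpace c = ⊤ := M.grading
  have h2 : (⨆ c, M.weightSpace c) ≤ LinearMap.ker f := iSup_le fun c w hw => h c w hw
  rw [h1, top_le_iff, LinearMap.ker_eq_top] at h2
  exact hf h2

/-- Schur's lemma: `f` preserves a nonzero finite-dimensional weight space and has an eigenvalue `a`
there; the kernel of `f - a` is a nonzero submodule, hence everything. -/
theorem IsSimple.eq_smul {M : TwistedModule g} (hM : M.IsSimple)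
    {f : M.carrier →ₗ[ℂ] M.carrier} (hf : IsHom f) : ∃ a : ℂ, ∀ m, f m = a • m := by
  have : Nontrivial M.carrier := hM.1
  obtain ⟨c, hc⟩ := M.exists_weightSpace_ne_bot
  have : FiniteDimensional ℂ (M.weightSpace c) := M.grading_finite c
  have : Nontrivial (M.weightSpace c) := Submodule.nontrivial_iff_ne_bot.2 hc
  obtain ⟨a, ha⟩ := Module.End.exists_eigenvalue
    (f.restrict (p := M.weightSpace c) (q := M.weightSpace c) fun _ h => hf.map_mem_weightSpace h)
  obtain ⟨x, hx, hx0⟩ := ha.exists_hasEigenvector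
  have hh : IsHom (f - a • LinearMap.id) := fun n v m => by
    simp [hf n v m]
  refine ⟨a, fun m => ?_⟩
  rcases hM.2 _ hh.isInvariant_ker with h | h
  · refine absurd (Subtype.ext ?_) hx0
    have hx' : (x : M.carrier) ∈ LinearMap.ker (f - a • LinearMap.id) := by
      have := congrArg Subtype.val (Module.End.mem_eigenspace_iff.1 hx)
      simpa [sub_eq_zero] using this
    rw [h] at hx'
    exact hx'
  · have hm : m ∈ LinearMap.ker (f - a • LinearMap.id) := h ▸ Submodule.mem_top
    simpa [sub_eq_zero] using hm

theorem Iso.isSimple {M M' : TwistedModule g} (h : M.Iso M') (hM : M.IsSimple) :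
    M'.IsSimple := by
  obtain ⟨φ, hφ⟩ := h
  have := hM.1
  refine ⟨φ.toEquiv.nontrivial_congr.1 this, fun W hW => ?_⟩
  have hinv : M.IsInvariant (W.comap φ.toLinearMap) := fun n v w hw => by
    change φ (M.mode n v w) ∈ W
    rw [hφ]
    exact hW n v _ hw
  rcases hM.2 _ hinv with h | h
  · left
    refine (Submodule.eq_bot_iff _).2 fun x hx => ?_
    have hx' : φ.symm x ∈ W.comap φ.toLinearMap := by simpa using hx
    rw [h] at hx'
    simpa using hx'
  · right
    refine eq_top_iff.2 fun x _ => ?_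
    have hx' : φ.symm x ∈ W.comap φ.toLinearMap := h ▸ Submodule.mem_top
    simpa using hx'

theorem mem_weightSpace_prod {M M' : TwistedModule g} {c : ℂ} {z : (M.prod M').carrier}
    (h₁ : z.1 ∈ M.weightSpace c) (h₂ : z.2 ∈ M'.weightSpace c) :
    z ∈ (M.prod M').weightSpace c :=
  Module.End.mem_eigenspace_iff.2
    (Prod.ext (Module.End.mem_eigenspace_iff.1 h₁) (Module.End.mem_eigenspace_iff.1 h₂))

/-- A nonzero `V^0`-homomorphism between simple twisted modules agrees with an isomorphism at a
weight vector. -/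
theorem exists_equiv_of_res_hom (hg : IsOfFinOrder g) {M M' : TwistedModule g} (hM : M.IsSimple)
    (hM' : M'.IsSimple) {f : M.carrier →ₗ[ℂ] M'.carrier}
    (hf : IsHom (M := M.res) (M' := M'.res) f) {c : ℂ} {w : M.carrier}
    (hw : w ∈ M.weightSpace c) (hfw : f w ≠ 0) :
    ∃ e : M.carrier ≃ₗ[ℂ] M'.carrier, IsHom e.toLinearMap ∧ e w = f w := by
  let P : TwistedModule g := M.prod M'
  let X : Submodule ℂ (M.carrier × M'.carrier) := ⨆ j, P.cyclicGrade (w, f w) j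
  have hX : ∀ (n : ℚ) (v : V) (x : M.carrier) (y : M'.carrier), (x, y) ∈ X →
      (M.mode n v x, M'.mode n v y) ∈ X := fun n v x y h =>
    P.iSup_cyclicGrade_isInvariant hg (w, f w) n v (x, y) h
  have hwX : (w, f w) ∈ X := P.self_mem_iSup_cyclicGrade hg (w, f w)
  have hw0 : w ≠ 0 := fun h => hfw (by rw [h, map_zero])
  have hfc : f w ∈ M'.weightSpace c := hf.map_mem_weightSpace hw
  have hpair : ∀ {x : M.carrier} {y : M'.carrier}, x ∈ M.weightSpace c → y ∈ M'.weightSpace c →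
      ((x, y) : P.carrier) ∈ P.weightSpace c := by
    intro x y hx hy
    exact mem_weightSpace_prod (M := M) (M' := M') (z := (x, y)) hx hy
  -- Both `(w, f w)` and `(0, f w)` have weight `c`, so membership in `X` would place `(0, f w)` in
  -- the `V^0`-submodule generated by `(w, f w)`. That submodule lies in the graph of `f`, and `f 0
  -- ≠ f w`.
  have hnot : ((0, f w) : M.carrier × M'.carrier) ∉ X := by
    intro h
    have h1 := P.mem_of_mem_iSup_cyclicGrade hg (w := (w, f w)) (x := (0, f w)) (d := 0)
      (hpair hw hfc) (by
        rw [Int.cast_zero, add_zero]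
        exact hpair (Submodule.zero_mem _) hfc) h (W := f.graph)
      ((f.mem_graph_iff _).2 rfl) (by
        rintro n v ⟨x, y⟩ hxy
        have hy : y = f x := (f.mem_graph_iff _).1 hxy
        refine (f.mem_graph_iff _).2 ?_
        change M'.mode n (v : V) y = f (M.mode n (v : V) x)
        rw [hy]
        exact (hf n v x).symm)
    have h2 : f w = f 0 := (f.mem_graph_iff _).1 h1
    rw [map_zero] at h2
    exact hfw h2
  -- Goursat's argument: by simplicity, the intersections of `X` with the two factors are zero and
  -- its projections to them are surjective.
  have hr : ∀ y, ((0, y) : M.carrier × M'.carrier) ∈ X → y = 0 := by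
    rcases hM'.2 (X.comap (LinearMap.inr ℂ M.carrier M'.carrier)) (fun n v y hy => by
      have := hX n v 0 y hy
      rwa [map_zero] at this) with h | h
    · intro y hy
      have hy' : y ∈ X.comap (LinearMap.inr ℂ M.carrier M'.carrier) := hy
      rwa [h] at hy'
    · have hy' : f w ∈ X.comap (LinearMap.inr ℂ M.carrier M'.carrier) := h ▸ Submodule.mem_top
      exact absurd hy' hnot
  have hl : ∀ x, ((x, 0) : M.carrier × M'.carrier) ∈ X → x = 0 := by
    rcases hM.2 (X.comap (LinearMap.inl ℂ M.carrier M'.carrier)) (fun n v y hy => by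
      have := hX n v y 0 hy
      rwa [map_zero] at this) with h | h
    · intro y hy
      have hy' : y ∈ X.comap (LinearMap.inl ℂ M.carrier M'.carrier) := hy
      rwa [h] at hy'
    · have hy' : w ∈ X.comap (LinearMap.inl ℂ M.carrier M'.carrier) := h ▸ Submodule.mem_top
      -- If `X` contained the first factor, it would contain `(w, f w) - (w, 0) = (0, f w)`.
      refine absurd ?_ hnot
      have := X.sub_mem hwX hy'
      simpa using this
  have hfst : ∀ x, ∃ y, (x, y) ∈ X := by
    rcases hM.2 (X.map (LinearMap.fst ℂ M.carrier M'.carrier)) (by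
      rintro n v _ ⟨⟨x, y⟩, hxy, rfl⟩
      exact ⟨_, hX n v x y hxy, rfl⟩) with h | h
    · have : w ∈ X.map (LinearMap.fst ℂ M.carrier M'.carrier) := ⟨_, hwX, rfl⟩
      rw [h] at this
      exact absurd this hw0
    · intro x
      have : x ∈ X.map (LinearMap.fst ℂ M.carrier M'.carrier) := h ▸ Submodule.mem_top
      obtain ⟨⟨_, y⟩, hxy, rfl⟩ := this
      exact ⟨y, hxy⟩
  have hsnd : ∀ y, ∃ x, (x, y) ∈ X := by
    rcases hM'.2 (X.map (LinearMap.snd ℂ M.carrier M'.carrier)) (by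
      rintro n v _ ⟨⟨x, y⟩, hxy, rfl⟩
      exact ⟨_, hX n v x y hxy, rfl⟩) with h | h
    · have : f w ∈ X.map (LinearMap.snd ℂ M.carrier M'.carrier) := ⟨_, hwX, rfl⟩
      rw [h] at this
      exact absurd this hfw
    · intro x
      have : x ∈ X.map (LinearMap.snd ℂ M.carrier M'.carrier) := h ▸ Submodule.mem_top
      obtain ⟨⟨y, _⟩, hxy, rfl⟩ := this
      exact ⟨y, hxy⟩
  obtain ⟨e, he⟩ := Submodule.exists_equiv_eq_graph (G := X)
    ⟨by
      rintro ⟨⟨x, y⟩, h1⟩ ⟨⟨x', y'⟩, h2⟩ (rfl : x = x')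
      have := hr (y - y') (by simpa using X.sub_mem h1 h2)
      rw [sub_eq_zero] at this
      subst this
      rfl,
    fun x => by
      obtain ⟨y, hy⟩ := hfst x
      exact ⟨⟨_, hy⟩, rfl⟩⟩
    ⟨by
      rintro ⟨⟨x, y⟩, h1⟩ ⟨⟨x', y'⟩, h2⟩ (rfl : y = y')
      have := hl (x - x') (by simpa using X.sub_mem h1 h2)
      rw [sub_eq_zero] at this
      subst this
      rfl,
    fun y => by
      obtain ⟨x, hx⟩ := hsnd y
      exact ⟨⟨_, hx⟩, rfl⟩⟩
  have hmem : ∀ x y, (x, y) ∈ X ↔ y = e x := fun x y => by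
    rw [he]
    exact LinearMap.mem_graph_iff _ _
  exact ⟨e, fun n v x => ((hmem _ _).1 (hX n v x (e x) ((hmem _ _).2 rfl))).symm,
    ((hmem _ _).1 hwX).symm⟩

/-! ### Components over `V^0` -/

/-- Sums of weight spaces over a union of cosets of `ℤ` are `V^0`-submodules. -/
theorem isInvariant_iSup_weightSpace (M : TwistedModule (1 : VOAut V)) {s : Set ℂ}
    (hs : ∀ e ∈ s, ∀ d : ℤ, e + d ∈ s) : M.IsInvariant (⨆ e ∈ s, M.weightSpace e) := by
  intro n v
  have h : (⨆ e ∈ s, M.weightSpace e) ≤ (⨆ e ∈ s, M.weightSpace e).comap (M.mode n v) := by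
    refine iSup₂_le fun e he x hx => ?_
    rw [Submodule.mem_comap]
    refine M.mode_mem_of_homogeneous IsOfFinOrder.one x n _ (fun r k v hr hk hn => ?_) v
    obtain ⟨l, hl⟩ := hn
    have hx' := M.mode_mem_weightSpace hk hx n
    refine Submodule.mem_iSup_of_mem _ (Submodule.mem_iSup_of_mem
      (hs e he (k - (r + l) - 1)) ?_)
    convert hx' using 3
    rw [hl, orderOf_one]
    push_cast
    ring
  exact h

theorem component_eq (M : TwistedModule g) (c : ℂ) (r : ℕ) :
    M.component c r = ⨆ e ∈ Set.range fun n : ℤ => c - (r : ℂ) / orderOf g + n,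
      M.weightSpace e := by
  rw [component, iSup_range]

theorem mode_mem_component (M : TwistedModule g) (c : ℂ) (r : ℕ) (n : ℚ) (v : fixed g)
    {x : M.carrier} (hx : x ∈ M.component c r) : M.mode n (v : V) x ∈ M.component c r := by
  rw [component_eq] at *
  refine M.res.isInvariant_iSup_weightSpace ?_ n v x hx
  rintro _ ⟨n, rfl⟩ d
  exact ⟨n + d, by push_cast; ring⟩

/-- The projection onto a component is a `V^0`-homomorphism. -/
theorem exists_component_projection (M : TwistedModule g) (c : ℂ) (r : ℕ) :
    ∃ p : M.carrier →ₗ[ℂ] M.component c r, (∀ x : M.component c r, p x = x) ∧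
      ∀ (n : ℚ) (v : fixed g) (x : M.carrier),
        (p (M.mode n (v : V) x) : M.carrier) = M.mode n (v : V) (p x) := by
  set s : Set ℂ := Set.range fun n : ℤ => c - (r : ℂ) / orderOf g + n
  -- The complement of a union of cosets of `ℤ` is again such a union, so the remaining weight
  -- spaces form a complementary `V^0`-submodule.
  let D : Submodule ℂ M.carrier := ⨆ e ∈ sᶜ, M.weightSpace e
  have hD : ∀ (n : ℚ) (v : fixed g), ∀ x ∈ D, M.mode n (v : V) x ∈ D := by
    refine M.res.isInvariant_iSup_weightSpace ?_
    rintro e he d ⟨n, hn⟩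
    exact he ⟨n - d, by push_cast; linear_combination hn⟩
  have hcompl : IsCompl (M.component c r) D := by
    rw [component_eq]
    constructor
    · exact M.weightSpace_iSupIndep.disjoint_biSup_biSup disjoint_compl_right
    · rw [codisjoint_iff, ← iSup_union, Set.union_compl_self, iSup_univ]
      exact M.grading
  obtain ⟨p, hp, hT⟩ := exists_projection hcompl
  exact ⟨p, hp, fun n v => hT (M.mode n (v : V)) (fun _ => M.mode_mem_component c r n v) (hD n v)⟩

/-- A nonzero `V^0`-homomorphism from a simple twisted module to a simple `V^0`-module is an
isomorphism on one component. -/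
theorem exists_isoComponent (hg : IsOfFinOrder g) {M : TwistedModule g} (hM : M.IsSimple)
    {N : TwistedModule (1 : VOAut (fixed g))} (hN : N.IsSimple)
    {f : M.carrier →ₗ[ℂ] N.carrier} (hf : IsHom (M := M.res) f) (hf0 : f ≠ 0) :
    ∃ c : ℂ, M.IsMinimalWeight c ∧ ∃ r < orderOf g, N.IsoComponent M c r := by
  have := hM.1
  have hK0 : (0 : ℤ) < orderOf g := by exact_mod_cast hg.orderOf_pos
  have hK : (orderOf g : ℂ) ≠ 0 := Nat.cast_ne_zero.2 hg.orderOf_pos.ne'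
  obtain ⟨c, hc⟩ := M.exists_isMinimalWeight hg
  obtain ⟨d, w, hw, hfw⟩ := exists_weight_vector hf0
  have hw0 : w ≠ 0 := fun h => hfw (by rw [h, map_zero])
  obtain ⟨j, hj⟩ := exists_weight_eq hg hM hc.1 (Submodule.ne_bot_iff _ |>.2 ⟨w, hw, hw0⟩)
  -- The weight of `w` is `c + j/K`, while `M^r` has weights in `c - r/K + ℤ`; hence the remainder
  -- of `-j`.
  obtain ⟨r, hr⟩ := Int.eq_ofNat_of_zero_le (Int.emod_nonneg (-j) hK0.ne')
  have hrK : r < orderOf g := by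
    have := Int.emod_lt_of_pos (-j) hK0
    omega
  have hd : d = c - (r : ℂ) / orderOf g + ((-(-j / orderOf g) : ℤ) : ℂ) := by
    have h3 : (j : ℂ) = - (orderOf g * ((-j / orderOf g : ℤ) : ℂ) + r) := by
      have h4 := Int.mul_ediv_add_emod (-j) (orderOf g)
      rw [hr] at h4
      rw [← neg_eq_iff_eq_neg]
      exact_mod_cast h4.symm
    rw [hj]
    conv_lhs => rw [h3]
    push_cast
    field_simp
    ring
  have hwC : w ∈ M.component c r := Submodule.mem_iSup_of_mem _ (hd ▸ hw)
  -- The intersection is spanned by weight vectors. A nonzero one would generate `w` over `V^0`, and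
  -- `f w` would vanish.
  have hker : LinearMap.ker f ⊓ M.component c r = ⊥ := by
    refine (Submodule.eq_bot_iff _).2 fun x hx => ?_
    have hst : ∀ x ∈ LinearMap.ker f ⊓ M.component c r, M.mode 1 VertexOperatorAlgebra.conf x ∈
        LinearMap.ker f ⊓ M.component c r := fun x hx =>
      ⟨hf.isInvariant_ker 1 VertexOperatorAlgebra.conf x hx.1,
        M.mode_mem_component c r 1 (VertexOperatorAlgebra.conf : fixed g) hx.2⟩
    have h1 := mem_iSup_inf_eigenspace M.grading hst hx
    have h2 : (⨆ e, (LinearMap.ker f ⊓ M.component c r) ⊓ M.weightSpace e) ≤ ⊥ := by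
      refine iSup_le fun e y hy => ?_
      obtain ⟨⟨hy1, hy2⟩, hy3⟩ := hy
      by_cases he : ∃ n : ℤ, c - (r : ℂ) / orderOf g + n = e
      · obtain ⟨n, hn⟩ := he
        by_contra hy0
        refine hfw (mem_of_isSimple hg hM (d := -(-j / orderOf g) - n) hy0 hy3 ?_
          (W := LinearMap.ker f) hy1 fun n v y hy => hf.isInvariant_ker n v y hy)
        convert hw using 2
        rw [hd, ← hn]
        push_cast
        ring
      · rw [component_eq] at hy2
        refine Submodule.disjoint_def.1 (M.weightSpace_iSupIndep e) y hy3 ?_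
        refine (iSup₂_le fun e' he' => ?_ :
          (⨆ e ∈ Set.range fun n : ℤ => c - (r : ℂ) / orderOf g + n, M.weightSpace e) ≤ _) hy2
        refine le_iSup₂_of_le e' (fun h => he ?_) le_rfl
        rw [← h]
        exact he'
    exact h2 h1
  let F : M.component c r →ₗ[ℂ] N.carrier := f.comp (M.component c r).subtype
  have hinj : Function.Injective F := by
    rw [injective_iff_map_eq_zero]
    intro x hx
    have : (x : M.carrier) ∈ LinearMap.ker f ⊓ M.component c r := ⟨hx, x.2⟩
    rw [hker] at this
    exact Subtype.ext this
  have hsurj : Function.Surjective F := by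
    have hinv : N.IsInvariant (LinearMap.range F) := by
      rintro n v _ ⟨x, rfl⟩
      exact ⟨⟨_, M.mode_mem_component c r n v x.2⟩, hf n v (x : M.carrier)⟩
    rcases hN.2 _ hinv with h | h
    · have hm : F ⟨w, hwC⟩ ∈ LinearMap.range F := ⟨_, rfl⟩
      rw [h] at hm
      exact absurd hm hfw
    · exact LinearMap.range_eq_top.1 h
  let E := LinearEquiv.ofBijective F ⟨hinj, hsurj⟩
  refine ⟨c, hc, r, hrK, E.symm, fun n v x => ?_⟩
  have h : E.symm (N.mode n v x) = ⟨_, M.mode_mem_component c r n v (E.symm x).2⟩ := by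
    rw [LinearEquiv.symm_apply_eq]
    have h1 : N.mode n v x = N.mode n v (F (E.symm x)) := by
      congr 1
      exact (E.apply_symm_apply x).symm
    rw [h1]
    exact (hf n v _).symm
  rw [h]

/-- `V^0`-homomorphisms from a simple twisted module to a `V^0`-module isomorphic to one of its
components are unique up to a scalar. -/
theorem exists_eq_smul_of_isoComponent (hg : IsOfFinOrder g) {M : TwistedModule g}
    (hM : M.IsSimple) {N : TwistedModule (1 : VOAut (fixed g))} (hN : N.IsSimple)
    {ι : N.carrier →ₗ[ℂ] M.res.carrier} (hι : IsHom ι) (hinj : Function.Injective ι)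
    {f f' : M.res.carrier →ₗ[ℂ] N.carrier} (hf : IsHom f) (hf' : IsHom f') (hf0 : f ≠ 0) : ∃ a : ℂ, f' = a • f := by
  -- Where `ι ∘ h` does not kill a weight vector, it agrees there with an automorphism of `M`, which
  -- is a scalar by Schur's lemma.
  have key : ∀ (h : M.res.carrier →ₗ[ℂ] N.carrier), IsHom h → ∀ (c : ℂ),
      ∀ w ∈ M.res.weightSpace c, ∃ b : ℂ, ι (h w) = b • w := by
    intro h hh c w hw
    by_cases h0 : ι (h w) = 0
    · exact ⟨0, by rw [h0, zero_smul]⟩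
    · obtain ⟨e, he, hew⟩ := exists_equiv_of_res_hom hg hM hM (f := ι.comp h)
        (hι.comp hh) hw h0
      obtain ⟨b, hb⟩ := hM.eq_smul he
      exact ⟨b, hew.symm.trans (hb w)⟩
  have hne : ∀ {h : M.res.carrier →ₗ[ℂ] N.carrier} {w : M.res.carrier} {b : ℂ}, h w ≠ 0 →
      ι (h w) = b • w → b ≠ 0 := by
    rintro h w b h0 hb rfl
    rw [zero_smul] at hb
    exact h0 (hinj (hb.trans (map_zero ι).symm))
  obtain ⟨c, w, hw, hfw⟩ := exists_weight_vector hf0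
  obtain ⟨b, hb⟩ := key f hf c w hw
  obtain ⟨b', hb'⟩ := key f' hf' c w hw
  have hb0 := hne hfw hb
  -- `h` kills `w`. If it were nonzero at a weight vector `x`, both `w` and `x` would lie in `ι N`,
  -- so the kernel of `h ∘ ι` would be neither zero nor all of the simple module `N`.
  let h : M.res.carrier →ₗ[ℂ] N.carrier := f' - (b' / b) • f
  have hh : IsHom h := Submodule.sub_mem (M.res.homs N) hf' (Submodule.smul_mem _ _ hf)
  refine ⟨b' / b, sub_eq_zero.1 (?_ : h = 0)⟩
  by_contra hh0
  have hιhw : h w = 0 := hinj (by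
    simp only [h, LinearMap.sub_apply, LinearMap.smul_apply, map_sub, map_smul, hb, hb', smul_smul,
      div_mul_cancel₀ _ hb0, sub_self, map_zero])
  obtain ⟨d, x, hx, hhx⟩ := exists_weight_vector hh0
  obtain ⟨b₁, hb₁⟩ := key h hh d x hx
  have hb₁0 := hne hhx hb₁
  have hcomp : IsHom (h.comp ι) := hh.comp hι
  have hw' : w = ι (b⁻¹ • f w) := by
    rw [map_smul, hb, smul_smul, inv_mul_cancel₀ hb0, one_smul]
  have hx' : x = ι (b₁⁻¹ • h x) := by
    rw [map_smul, hb₁, smul_smul, inv_mul_cancel₀ hb₁0, one_smul]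
  rcases hN.2 _ hcomp.isInvariant_ker with h1 | h1
  · have hm : b⁻¹ • f w ∈ LinearMap.ker (h.comp ι) := by
      rw [LinearMap.mem_ker, LinearMap.comp_apply, ← hw', hιhw]
    rw [h1] at hm
    exact (smul_ne_zero (inv_ne_zero hb0) hfw) hm
  · have hm : b₁⁻¹ • h x ∈ LinearMap.ker (h.comp ι) := h1 ▸ Submodule.mem_top
    rw [LinearMap.mem_ker, LinearMap.comp_apply, ← hx'] at hm
    exact hhx hm

/-- The weights of `M` lie in `K` cosets of `ℤ`. A `V^0`-homomorphism is determined on each of them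
by its value at one nonzero weight vector, and this value lies in a finite-dimensional weight space
of `N`. -/
theorem finiteDimensional_homs_res (hg : IsOfFinOrder g) {M : TwistedModule g} (hM : M.IsSimple)
    (N : TwistedModule (1 : VOAut (fixed g))) : FiniteDimensional ℂ (M.res.homs N) := by
  have := hM.1
  have hK0 : (0 : ℤ) < orderOf g := by exact_mod_cast hg.orderOf_pos
  have hK : (orderOf g : ℂ) ≠ 0 := Nat.cast_ne_zero.2 hg.orderOf_pos.ne'
  obtain ⟨c, hc⟩ := M.exists_weightSpace_ne_bot
  have hex : ∀ r : Fin (orderOf g), ∃ (e : ℂ) (w : M.weightSpace e), ∀ (n : ℤ),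
      ∀ x ∈ M.weightSpace (c + (r : ℂ) / orderOf g + n), x ≠ 0 →
        w ≠ 0 ∧ ∃ d : ℤ, c + (r : ℂ) / orderOf g + n = e + d := by
    intro r
    by_cases h : ∃ n : ℤ, M.weightSpace (c + (r : ℂ) / orderOf g + n) ≠ ⊥
    · obtain ⟨n, hn⟩ := h
      obtain ⟨w, hw, hw0⟩ := Submodule.exists_mem_ne_zero_of_ne_bot hn
      refine ⟨_, ⟨w, hw⟩, fun n' x _ _ => ⟨fun h => hw0 (congrArg Subtype.val h), n' - n, ?_⟩⟩
      push_cast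
      ring
    · push Not at h
      -- A coset containing no weight gets the zero vector; the condition is then vacuous.
      refine ⟨0, 0, fun n x hx hx0 => absurd ?_ hx0⟩
      rwa [h n] at hx
  choose e w hew using hex
  have hfin : ∀ r, FiniteDimensional ℂ (N.weightSpace (e r)) := fun r => N.grading_finite (e r)
  let ev : M.res.homs N →ₗ[ℂ] ∀ r, N.weightSpace (e r) :=
    { toFun := fun f r => ⟨f.1 (w r : M.carrier), IsHom.map_mem_weightSpace f.2 (w r).2⟩
      map_add' := fun _ _ => rfl
      map_smul' := fun _ _ => rfl }
  refine FiniteDimensional.of_injective ev ?_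
  rw [injective_iff_map_eq_zero]
  intro f hf
  by_contra hf0
  obtain ⟨d, x, hx, hfx⟩ := exists_weight_vector (M := M.res) (f := f.1) fun h => hf0 (Subtype.ext h)
  have hx0 : x ≠ 0 := fun h => hfx (by rw [h, map_zero])
  obtain ⟨j, hj⟩ := exists_weight_eq hg hM hc (Submodule.ne_bot_iff _ |>.2 ⟨x, hx, hx0⟩)
  obtain ⟨r, hr⟩ := Int.eq_ofNat_of_zero_le (Int.emod_nonneg j hK0.ne')
  have hrK : r < orderOf g := by
    have := Int.emod_lt_of_pos j hK0
    omega
  have hd : d = c + (r : ℂ) / orderOf g + ((j / orderOf g : ℤ) : ℂ) := by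
    have h3 : (j : ℂ) = orderOf g * ((j / orderOf g : ℤ) : ℂ) + r := by
      have h4 := Int.mul_ediv_add_emod j (orderOf g)
      rw [hr] at h4
      exact_mod_cast h4.symm
    rw [hj]
    conv_lhs => rw [h3]
    field_simp
    ring
  obtain ⟨hw0, i, hi⟩ := hew ⟨r, hrK⟩ _ x (hd ▸ hx) hx0
  refine hfx (mem_of_isSimple hg hM (w := w ⟨r, hrK⟩) (d := i) (fun h => hw0 (Subtype.ext h))
    (w ⟨r, hrK⟩).2 ?_ (W := LinearMap.ker f.1) ?_ fun n v y hy =>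
      IsHom.isInvariant_ker f.2 n v y hy)
  · rw [← hi, ← hd]
    exact hx
  · exact LinearMap.mem_ker.2 (congrArg Subtype.val (congrFun hf ⟨r, hrK⟩))

end TwistedModule

open TwistedModule

/-! ### Frobenius reciprocity -/

/-- The homomorphism `M → Ind N` attached to a `V^0`-homomorphism `M → N`. -/
def toInd {M : TwistedModule g} {N : TwistedModule (1 : VOAut (fixed g))}
    (f : M.res.homs N) : M.carrier →ₗ[A g] Ind g N where
  toFun m := ⟨⟨AddMonoidHom.mk' (fun a : A g => f.1 (a • m : M.carrier)) fun a b =>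
      (congrArg f.1 (add_smul a b m)).trans (f.1.map_add _ _),
    fun a x => by
      change f.1 ((psi g a * x) • m : M.carrier) = a • f.1 (x • m : M.carrier)
      rw [mul_smul, res_smul]
      exact smul_map f.1 f.2 a _⟩,
    -- If `a m = 0` then `f ((b a) m) = f (b (a m)) = 0` for all `b`, so the image of `m` lies in
    -- the continuous part.
    ⟨M.ann m, ⟨M, m, rfl⟩, fun a ha => Subtype.ext (AddMonoidHom.ext fun b => by
      change f.1 ((b * a) • m : M.carrier) = 0
      have ha' : a • m = 0 := ha
      rw [mul_smul, ha', smul_zero]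
      exact f.1.map_zero)⟩⟩
  map_add' m m' := Subtype.ext (Subtype.ext (AddMonoidHom.ext fun b =>
    (congrArg f.1 (smul_add b m m')).trans (f.1.map_add _ _)))
  map_smul' a m := Subtype.ext (Subtype.ext (AddMonoidHom.ext fun b =>
    congrArg f.1 (mul_smul b a m).symm))

theorem toInd_apply {M : TwistedModule g} {N : TwistedModule (1 : VOAut (fixed g))}
    (f : M.res.homs N) (m : M.carrier) (a : A g) :
    (toInd f m).1.1 a = f.1 (a • m : M.carrier) := rfl

theorem Ind.ext {N : TwistedModule (1 : VOAut (fixed g))} {x y : Ind g N}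
    (h : ∀ a, x.1.1 a = y.1.1 a) : x = y :=
  Subtype.ext (Subtype.ext (AddMonoidHom.ext h))

/-- The evaluation at `1`. -/
def Ind.eval (g : VOAut V) (N : TwistedModule (1 : VOAut (fixed g))) : Ind g N →+ N.carrier where
  toFun x := x.1.1 1
  map_zero' := rfl
  map_add' _ _ := rfl

theorem Ind.eval_smul {N : TwistedModule (1 : VOAut (fixed g))} (a : A g) (x : Ind g N) :
    Ind.eval g N (a • x) = x.1.1 a :=
  congrArg x.1.1 (one_mul a)

theorem Ind.eval_psi_smul {N : TwistedModule (1 : VOAut (fixed g))}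
    (a : A (1 : VOAut (fixed g))) (x : Ind g N) :
    Ind.eval g N (psi g a • x) = a • Ind.eval g N x :=
  (Ind.eval_smul _ x).trans ((congrArg x.1.1 (mul_one _)).symm.trans (x.1.2 a 1))

theorem Ind.eval_toInd {M : TwistedModule g} {N : TwistedModule (1 : VOAut (fixed g))}
    (f : M.res.homs N) (m : M.carrier) : Ind.eval g N (toInd f m) = f.1 m :=
  congrArg f.1 (one_smul (A g) m)

/-- The `V^0`-homomorphism is `φ` followed by evaluation at `1`. It is linear over the algebra of
`V^0`, and this forces it to be `ℂ`-linear and to commute with the modes of `V^0`. -/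
theorem exists_eq_toInd {M : TwistedModule g}
    {N : TwistedModule (1 : VOAut (fixed g))} (φ : M.carrier →ₗ[A g] Ind g N) :
    ∃ f : M.res.homs N, φ = toInd f := by
  let f₀ : M.carrier →+ N.carrier := (Ind.eval g N).comp φ.toAddMonoidHom
  have hA₀ : ∀ (a : A (1 : VOAut (fixed g))) (m : M.carrier), f₀ (psi g a • m) = a • f₀ m :=
    fun a m => (congrArg (Ind.eval g N) (φ.map_smul (psi g a) m)).trans (Ind.eval_psi_smul a _)
  -- The same map, retyped so that its source carries the action of the algebra of `V^0`.
  let f₁ : M.res.carrier →+ N.carrier := f₀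
  have hA : ∀ (a : A (1 : VOAut (fixed g))) (m : M.res.carrier), f₁ (a • m) = a • f₁ m :=
    fun a m => (congrArg f₀ (M.res_smul a m)).symm.trans (hA₀ a m)
  let f : M.res.carrier →ₗ[ℂ] N.carrier := { f₁ with map_smul' := map_complex_smul hA }
  have hfin : IsOfFinOrder (1 : VOAut (fixed g)) := IsOfFinOrder.one
  have hf : IsHom f := map_mode_of_map_smul hfin hA
  refine ⟨⟨f, hf⟩, LinearMap.ext fun m => Ind.ext fun a => ?_⟩
  rw [toInd_apply]
  exact ((congrArg (Ind.eval g N) (φ.map_smul a m)).trans (Ind.eval_smul a _)).symm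

theorem toInd_injective {M : TwistedModule g} {N : TwistedModule (1 : VOAut (fixed g))}
    {f f' : M.res.homs N} (h : toInd f = toInd f') : f = f' :=
  Subtype.ext (LinearMap.ext fun m => (Ind.eval_toInd f m).symm.trans
    ((congrArg (Ind.eval g N) (DFunLike.congr_fun h m)).trans (Ind.eval_toInd f' m)))

theorem toInd_add {M : TwistedModule g} {N : TwistedModule (1 : VOAut (fixed g))}
    (f f' : M.res.homs N) : toInd (f + f') = toInd f + toInd f' :=
  LinearMap.ext fun _ => Ind.ext fun _ => rfl

/-- The scalar is moved to the argument, so no `ℂ`-structure on `Ind g N` is needed. -/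
theorem toInd_smul_apply {M : TwistedModule g} {N : TwistedModule (1 : VOAut (fixed g))}
    (c : ℂ) (f : M.res.homs N) (m : M.carrier) : toInd (c • f) m = toInd f (c • m) :=
  Ind.ext fun a => by
    have h : a • c • m = c • a • m := smul_comm a c m
    exact (f.1.map_smul c _).symm.trans (congrArg f.1 h.symm)

/-- Naturality of reciprocity in the twisted module. -/
theorem toInd_comp_apply {S M : TwistedModule g} {N : TwistedModule (1 : VOAut (fixed g))}
    {e : S.carrier →ₗ[ℂ] M.carrier} (he : IsHom e) {f : M.res.homs N} {f' : S.res.homs N}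
    (h : ∀ m : S.carrier, f'.1 m = f.1 (e m)) (m : S.carrier) : toInd f' m = toInd f (e m) :=
  Ind.ext fun a => (h _).trans (congrArg f.1 (smul_map e he a m))

/-- The properties of an `A(g)`-module `X` that identify it with `Ind N`: Frobenius reciprocity,
and every element is annihilated by the annihilator of an element of a twisted module. -/
structure Reciprocity (N : TwistedModule (1 : VOAut (fixed g))) (X : Type*) [AddCommGroup X]
    [Module (A g) X] where
  hom : ∀ M : TwistedModule g, M.res.homs N → (M.carrier →ₗ[A g] X)
  hom_injective : ∀ M, Function.Injective (hom M)
  hom_surjective : ∀ M, Function.Surjective (hom M)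
  hom_add : ∀ (M : TwistedModule g) (f f' : M.res.homs N), hom M (f + f') = hom M f + hom M f'
  hom_smul_apply : ∀ (M : TwistedModule g) (c : ℂ) (f : M.res.homs N) (m : M.carrier),
    hom M (c • f) m = hom M f (c • m)
  hom_comp_apply : ∀ (S M : TwistedModule g) (e : S.carrier →ₗ[ℂ] M.carrier), IsHom e →
    ∀ (f : M.res.homs N) (f' : S.res.homs N), (∀ m : S.carrier, f'.1 m = f.1 (e m)) →
      ∀ m : S.carrier, hom S f' m = hom M f (e m)
  exists_ann : ∀ x : X, ∃ (M : TwistedModule g) (m : M.carrier),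
    ∀ a : A g, a • m = 0 → a • x = 0

/-- Frobenius reciprocity for `Ind N`. -/
def Ind.reciprocity (g : VOAut V) (N : TwistedModule (1 : VOAut (fixed g))) :
    Reciprocity N (Ind g N) where
  hom _ := toInd
  hom_add _ := toInd_add
  hom_injective _ _ _ h := toInd_injective h
  hom_surjective _ φ := (exists_eq_toInd φ).imp fun _ h => h.symm
  hom_smul_apply _ c f m := toInd_smul_apply c f m
  hom_comp_apply _ _ _ he _ _ h m := toInd_comp_apply he h m
  exists_ann x := by
    obtain ⟨_, ⟨M, m, rfl⟩, hJ⟩ := x.2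
    exact ⟨M, m, fun a ha => Subtype.ext (hJ a ha)⟩

/-- The images of finitely many twisted modules lie in the image of one. -/
theorem exists_range_le {X ι : Type*} [AddCommGroup X] [Module (A g) X] (s : Finset ι)
    (M : ι → TwistedModule g) (φ : ∀ i, (M i).carrier →ₗ[A g] X) :
    ∃ (M' : TwistedModule g) (φ' : M'.carrier →ₗ[A g] X),
      ∀ i ∈ s, LinearMap.range (φ i) ≤ LinearMap.range φ' := by
  classical
  induction s using Finset.induction_on with
  | empty => exact ⟨.zero g, 0, by simp⟩
  | insert a s ha ih =>
    obtain ⟨M', φ', h⟩ := ih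
    let P := (M a).prod M'
    let p₁ : P.carrier →ₗ[A g] (M a).carrier := toLinearMapA (M := P)
      (LinearMap.fst ℂ (M a).carrier M'.carrier) fun _ _ _ => rfl
    let p₂ : P.carrier →ₗ[A g] M'.carrier := toLinearMapA (M := P)
      (LinearMap.snd ℂ (M a).carrier M'.carrier) fun _ _ _ => rfl
    let Φ : P.carrier →ₗ[A g] X := (φ a).comp p₁ + φ'.comp p₂
    have hΦ : ∀ x y, Φ (x, y) = φ a x + φ' y := fun _ _ => rfl
    refine ⟨P, Φ, fun i hi => ?_⟩
    rcases Finset.mem_insert.1 hi with rfl | hi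
    · rintro _ ⟨x, rfl⟩
      exact ⟨(x, 0), by rw [hΦ, map_zero, add_zero]⟩
    · refine (h i hi).trans ?_
      rintro _ ⟨y, rfl⟩
      exact ⟨(0, y), by rw [hΦ, map_zero, zero_add]⟩

/-- A quotient of a completely reducible twisted module is a twisted module. -/
theorem exists_equiv_of_surjective (hg : IsOfFinOrder g) {X : Type*} [AddCommGroup X]
    [Module (A g) X] {M : TwistedModule g} (hM : M.IsCompletelyReducible)
    (φ : M.carrier →ₗ[A g] X) (hφ : Function.Surjective φ) :
    ∃ M' : TwistedModule g, Nonempty (X ≃ₗ[A g] M'.carrier) := by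
  have := isSemisimpleModule hg hM
  -- The quotient by the kernel is isomorphic to a complement, and submodules of twisted modules are
  -- twisted modules.
  obtain ⟨C, hC⟩ := exists_isCompl (LinearMap.ker φ)
  exact ⟨M.ofSubmodule hg C, ⟨(φ.quotKerEquivOfSurjective hφ).symm.trans
    ((Submodule.quotientEquivOfIsCompl _ _ hC).trans (M.ofSubmoduleEquiv hg C).symm)⟩⟩

/-! ### Modules satisfying Frobenius reciprocity -/

namespace Reciprocity

variable {N : TwistedModule (1 : VOAut (fixed g))} {X : Type*} [AddCommGroup X] [Module (A g) X]

theorem hom_zero (F : Reciprocity N X) (M : TwistedModule g) : F.hom M 0 = 0 := by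
  have h := F.hom_add M 0 0
  rwa [add_zero, left_eq_add] at h

/-- `X` is generated by the images of the simple twisted modules. -/
theorem eq_top_of_range_le (hg : IsOfFinOrder g) (hss : IsSemisimpleCat g)
    (F : Reciprocity N X) (Y : Submodule (A g) X)
    (hY : ∀ M : TwistedModule g, M.IsSimple → ∀ φ : M.carrier →ₗ[A g] X,
      LinearMap.range φ ≤ Y) : Y = ⊤ := by
  refine eq_top_iff.2 fun x _ => ?_
  obtain ⟨M, m, hJ⟩ := F.exists_ann x
  have := isSemisimpleModule hg (hss M)
  let s := LinearMap.toSpanSingleton (A g) M.carrier m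
  let t := LinearMap.toSpanSingleton (A g) X x
  have hst : LinearMap.ker s ≤ LinearMap.ker t := fun a ha => hJ a ha
  -- The map `a m ↦ a x` on `A(g) m`, well defined because `Ann(m)` kills `x`.
  let ψ : LinearMap.range s →ₗ[A g] X :=
    ((LinearMap.ker s).liftQ t hst).comp s.quotKerEquivRange.symm.toLinearMap
  have hψ : ψ ⟨s 1, 1, rfl⟩ = x := by
    have h1 : s.quotKerEquivRange.symm ⟨s 1, 1, rfl⟩ = Submodule.Quotient.mk 1 := by
      rw [LinearEquiv.symm_apply_eq]
      rfl
    change (LinearMap.ker s).liftQ t hst (s.quotKerEquivRange.symm ⟨s 1, 1, rfl⟩) = x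
    rw [h1]
    exact one_smul (A g) x
  -- `A(g) m` is the sum of its simple submodules `T`, and `ψ` maps each of them into `Y` because
  -- `T` is a simple twisted module.
  have hle : LinearMap.range s ≤ (Y.comap ψ).map (LinearMap.range s).subtype := by
    refine (IsSemisimpleModule.sSup_simples_le (LinearMap.range s)).ge.trans (sSup_le ?_)
    rintro T ⟨hT, hTs⟩ y hy
    have h := hY (M.ofSubmodule hg T) (M.isSimple_ofSubmodule hg T)
      (ψ.comp ((Submodule.inclusion hTs).comp (M.ofSubmoduleEquiv hg T).toLinearMap))
    exact ⟨⟨y, hTs hy⟩, h ⟨⟨y, hy⟩, rfl⟩, rfl⟩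
  obtain ⟨y, hy, hyx⟩ := hle ⟨1, rfl⟩
  have : y = ⟨s 1, 1, rfl⟩ := Subtype.ext hyx
  subst this
  rw [← hψ]
  exact hy

/-- The images of all homomorphisms from a simple twisted module lie in the image of one twisted
module. -/
theorem exists_range_le_of_isSimple (hg : IsOfFinOrder g) {S : TwistedModule g}
    (hS : S.IsSimple) (F : Reciprocity N X) :
    ∃ (M : TwistedModule g) (φ : M.carrier →ₗ[A g] X),
      ∀ ψ : S.carrier →ₗ[A g] X, LinearMap.range ψ ≤ LinearMap.range φ := by
  have := finiteDimensional_homs_res hg hS N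
  obtain ⟨t, ht⟩ := (Module.Finite.fg_top : (⊤ : Submodule ℂ (S.res.homs N)).FG)
  obtain ⟨M, φ, h⟩ := exists_range_le t (fun _ => S) fun f => F.hom S f
  refine ⟨M, φ, fun ψ => ?_⟩
  obtain ⟨f, rfl⟩ := F.hom_surjective S ψ
  have hspan : ∀ f ∈ Submodule.span ℂ (t : Set (S.res.homs N)),
      LinearMap.range (F.hom S f) ≤ LinearMap.range φ := by
    intro f hf
    induction hf using Submodule.span_induction with
    | mem f hf => exact h f hf
    | zero =>
      rintro _ ⟨x, rfl⟩
      rw [F.hom_zero]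
      exact Submodule.zero_mem _
    | add f f' _ _ hf hf' =>
      rintro _ ⟨x, rfl⟩
      rw [F.hom_add]
      exact Submodule.add_mem _ (hf ⟨x, rfl⟩) (hf' ⟨x, rfl⟩)
    | smul c f _ hf =>
      rintro _ ⟨x, rfl⟩
      rw [F.hom_smul_apply]
      exact hf ⟨_, rfl⟩
  exact hspan f (ht ▸ Submodule.mem_top)

/-- If `ψ` comes from a nonzero `f' : S → N`, then `ι ∘ f'` is a nonzero `V^0`-map `S → M`, whence
`S ≅ M`. Transported to `M`, the map `f'` is a scalar multiple of `f` by multiplicity one, so it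
contributes no new image. -/
theorem range_le (hg : IsOfFinOrder g) {S M : TwistedModule g} (hS : S.IsSimple)
    (hM : M.IsSimple) (hN : N.IsSimple) (F : Reciprocity N X)
    {ι : N.carrier →ₗ[ℂ] M.res.carrier} (hι : IsHom ι) (hinj : Function.Injective ι)
    (f : M.res.homs N) (hf0 : f.1 ≠ 0) (ψ : S.carrier →ₗ[A g] X) :
    LinearMap.range ψ ≤ LinearMap.range (F.hom M f) := by
  obtain ⟨⟨f', hf'⟩, rfl⟩ := F.hom_surjective S ψ
  by_cases hf'0 : f' = 0
  · have h : (⟨f', hf'⟩ : S.res.homs N) = 0 := Subtype.ext hf'0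
    rw [h, F.hom_zero, LinearMap.range_zero]
    exact bot_le
  · obtain ⟨d, w, hw, hfw⟩ := exists_weight_vector hf'0
    obtain ⟨e, he, -⟩ := exists_equiv_of_res_hom hg hS hM (f := ι.comp f') (hι.comp hf')
      hw fun h => hfw (hinj (h.trans (map_zero ι).symm))
    have he' : IsHom e.symm.toLinearMap := fun n v m => e.injective (by
      have := he n v (e.symm m)
      simpa using this.symm)
    let k : M.res.carrier →ₗ[ℂ] S.res.carrier := e.symm.toLinearMap
    have hk : IsHom k := fun n v m => he' n v m
    obtain ⟨a, ha⟩ := exists_eq_smul_of_isoComponent hg hM hN hι hinj f.2 (hf'.comp hk) hf0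
    rintro _ ⟨m, rfl⟩
    -- On `S` one has `f' = a f ∘ e`, and the scalar is absorbed by the argument.
    refine ⟨a • e m, ?_⟩
    rw [← F.hom_smul_apply]
    exact (F.hom_comp_apply S M e.toLinearMap he (a • f) ⟨f', hf'⟩ (fun m =>
      (congrArg f' (e.symm_apply_apply m)).symm.trans (DFunLike.congr_fun ha (e m))) m).symm

/-- Projecting `M` to its component gives a nonzero `V^0`-map `f : M → N`. The corresponding map `M
→ X` is nonzero, hence injective as `M` is simple; it is surjective because no simple module has an
image outside its range. -/
theorem nonempty_equiv (hg : IsOfFinOrder g) (hss : IsSemisimpleCat g)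
    (F : Reciprocity N X) (hN : N.IsSimple) {M : TwistedModule g}
    (hM : M.IsSimple) {c : ℂ} {r : ℕ} (hNM : N.IsoComponent M c r) :
    Nonempty (X ≃ₗ[A g] M.carrier) := by
  obtain ⟨φ, hφ⟩ := hNM
  obtain ⟨p, hp, hpm⟩ := M.exists_component_projection c r
  have hNnt := hN.1
  let ι : N.carrier →ₗ[ℂ] M.res.carrier := (M.component c r).subtype.comp φ.toLinearMap
  have hι : IsHom ι := fun n v x => hφ n v x
  have hinj : Function.Injective ι := Subtype.val_injective.comp φ.injective
  let f : M.res.carrier →ₗ[ℂ] N.carrier := φ.symm.toLinearMap.comp p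
  have hfι : ∀ x, f (ι x) = x := fun x => by
    change φ.symm (p (φ x)) = x
    rw [hp, LinearEquiv.symm_apply_apply]
  have hιf : ∀ m : M.carrier, ι (f m) = (p m : M.carrier) := fun m =>
    congrArg Subtype.val (φ.apply_symm_apply (p m))
  have hf : IsHom f := fun n v m => hinj (by
    refine Eq.trans ?_ (hι n v (f m)).symm
    exact (hιf _).trans ((hpm n v m).trans (congrArg (M.mode n (v : V)) (hιf m).symm)))
  obtain ⟨x, hx⟩ := exists_ne (0 : N.carrier)
  have hf0 : f ≠ 0 := fun h => hx (by rw [← hfι x, h, LinearMap.zero_apply])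
  let Φ := F.hom M ⟨f, hf⟩
  have hΦinj : Function.Injective Φ := by
    have hker : M.IsInvariant ((LinearMap.ker Φ).restrictScalars ℂ) :=
      M.isInvariant_restrictScalars hg _
    rcases hM.2 _ hker with h | h
    · exact LinearMap.ker_eq_bot.1 ((Submodule.restrictScalars_eq_bot_iff ℂ _ _).1 h)
    · refine absurd (congrArg Subtype.val (F.hom_injective M (a₁ := ⟨f, hf⟩) (a₂ := 0)
        ((LinearMap.ext fun m => ?_ : Φ = 0).trans (F.hom_zero M).symm))) hf0
      have hm : m ∈ (LinearMap.ker Φ).restrictScalars ℂ := h ▸ Submodule.mem_top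
      exact hm
  have hΦtop : LinearMap.range Φ = ⊤ := by
    refine F.eq_top_of_range_le hg hss _ fun S hS ψ => ?_
    exact F.range_le hg hS hM hN hι hinj ⟨f, hf⟩ hf0 ψ
  exact ⟨(LinearEquiv.ofBijective Φ ⟨hΦinj, LinearMap.range_eq_top.1 hΦtop⟩).symm⟩

/-- A simple twisted module with nonzero image in `X` would give a nonzero `V^0`-map to `N` and so
exhibit `N` as a component. -/
theorem subsingleton (hg : IsOfFinOrder g) (hss : IsSemisimpleCat g)
    (F : Reciprocity N X) (hN : N.IsSimple)
    (h : ¬ ∃ M : TwistedModule g, M.IsSimple ∧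
      ∃ c : ℂ, M.IsMinimalWeight c ∧ ∃ r < orderOf g, N.IsoComponent M c r) :
    Subsingleton X := by
  have hbot : (⊥ : Submodule (A g) X) = ⊤ := by
    refine F.eq_top_of_range_le hg hss _ fun M hM φ => ?_
    obtain ⟨f, rfl⟩ := F.hom_surjective M φ
    have hf0 : f = 0 := by
      by_contra hf0
      exact h ⟨M, hM, exists_isoComponent hg hM hN f.2 fun h => hf0 (Subtype.ext h)⟩
    rw [hf0, F.hom_zero, LinearMap.range_zero]
  exact (Submodule.subsingleton_iff (A g)).1 (subsingleton_of_bot_eq_top hbot)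

/-- Each of the finitely many simple modules contributes an image covered by one twisted module.
Their direct sum maps onto `X`, and semisimplicity turns this quotient into a submodule. -/
theorem exists_equiv (hg : IsOfFinOrder g) (hss : IsSemisimpleCat g)
    (hfin : HasFinitelyManySimples g) (F : Reciprocity N X) :
    ∃ M : TwistedModule g, Nonempty (X ≃ₗ[A g] M.carrier) := by
  obtain ⟨n, S, hS⟩ := hfin
  have hex : ∀ i, ∃ (M : TwistedModule g) (φ : M.carrier →ₗ[A g] X), (S i).IsSimple →
      ∀ ψ : (S i).carrier →ₗ[A g] X, LinearMap.range ψ ≤ LinearMap.range φ := by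
    intro i
    by_cases hi : (S i).IsSimple
    · obtain ⟨M, φ, h⟩ := F.exists_range_le_of_isSimple hg hi
      exact ⟨M, φ, fun _ => h⟩
    -- The list `S` may contain modules that are not simple; they are not needed and get the zero
    -- map.
    · exact ⟨.zero g, 0, fun h => absurd h hi⟩
  choose M φ h using hex
  obtain ⟨M', φ', h'⟩ := exists_range_le Finset.univ M φ
  refine exists_equiv_of_surjective hg (hss M') φ' (LinearMap.range_eq_top.1 ?_)
  refine F.eq_top_of_range_le hg hss _ fun M₁ hM₁ ψ => ?_
  obtain ⟨i, hi⟩ := hS M₁ hM₁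
  obtain ⟨e, he⟩ := id hi
  have he' : ∀ (n : ℚ) (v : V) (m : (S i).carrier),
      e.symm ((S i).mode n v m) = M₁.mode n v (e.symm m) := fun n v m => e.injective (by
    rw [he, e.apply_symm_apply, e.apply_symm_apply])
  refine le_trans ?_ ((h i (hi.isSimple hM₁) (ψ.comp (toLinearMapA e.symm.toLinearMap he'))).trans
    (h' i (Finset.mem_univ i)))
  rintro _ ⟨m, rfl⟩
  exact ⟨e m, congrArg ψ (e.symm_apply_apply m)⟩

end Reciprocity

end TwistedVOA

end

open TwistedVOA

theorem mainTheorem7 {V : Type u} [AddCommGroup V] [Module ℂ V] [VertexOperatorAlgebra V]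
    (g : VOAut V) (hg : IsOfFinOrder g) (hV : IsSimpleVOA V) (hss : IsSemisimpleCat g) :
    (∀ N : TwistedModule (1 : VOAut (fixed g)), N.IsSimple →
      (∀ M : TwistedModule g, M.IsSimple →
        (∃ c : ℂ, M.IsMinimalWeight c ∧ ∃ r < orderOf g, N.IsoComponent M c r) →
          Nonempty (Ind g N ≃ₗ[A g] M.carrier)) ∧
      ((¬ ∃ M : TwistedModule g, M.IsSimple ∧
        ∃ c : ℂ, M.IsMinimalWeight c ∧ ∃ r < orderOf g, N.IsoComponent M c r) →
          Subsingleton (Ind g N))) ∧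
    (HasFinitelyManySimples g → ∀ N : TwistedModule (1 : VOAut (fixed g)),
      ∃ M : TwistedModule g, Nonempty (Ind g N ≃ₗ[A g] M.carrier)) :=
  ⟨fun N hN => ⟨fun _ hM ⟨_, _, _, _, h⟩ => (Ind.reciprocity g N).nonempty_equiv hg hss hN hM h,
    (Ind.reciprocity g N).subsingleton hg hss hN⟩,
    fun hfin N => (Ind.reciprocity g N).exists_equiv hg hss hfin⟩
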